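/- Let $\Omega\subset\mathbb{R}^n$ be a bounded domain (nonempty, open, connected), and let $V\in L^\infty(\mathbb{R}^n)$ be real-valued with $\operatorname{supp}V=\overline{\Omega}$ and $V\ge\delta$ a.e. in $\Omega$ for some constant $\delta>0$. Let $$P_0(D)=\sum_{|\alpha|\le m}a_\alpha D^\alpha,\qquad a_\alpha\in\mathbb{R},\quad D_j=-i\,\partial/\partial x_j,$$ be a partial differential operator with constant real coefficients of order $m\ge 2$, with symbol $P_0(\xi)=\sum_\alpha a_\alpha\xi^\alpha$, and put $\widetilde P_0(\xi)=\bigl(\sum_{\alpha}|\partial^\alpha P_0(\xi)|^2\bigr)^{1/2}$, the sum being over all multi-indices $\alpha\in\mathbb{N}^n$. Let $H^{P_0}_0(\Omega)$ be the completion of $C_0^\infty(\Omega)$ in the norm $\|P_0(D)\varphi\|_{L^2}$, regarded as a subspace of $L^2(\Omega)$: it consists of the $L^2(\Omega)$-limits of sequences in $C_0^\infty(\Omega)$ that are Cauchy in this norm. A number $\lambda\in\mathbb{C}$ is called a transmission eigenvalue if there are $0\ne v\in L^2_{\mathrm{loc}}(\Omega)$ and $0\ne w\in L^2_{\mathrm{loc}}(\Omega)$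 such that $$(P_0-\lambda)v=0\ \text{ in }\Omega,\qquad (P_0+V-\lambda)w=0\ \text{ in }\Omega,\qquad v-w\in H^{P_0}_0(\Omega),$$ where the equations hold in the sense of distributions. Assume that $\widetilde P_0(\xi)\to\infty$ as $|\xi|\to\infty$ and that $P_0(\xi)$ or $-P_0(\xi)$ is bounded from below on $\mathbb{R}^n$. Then the set of transmission eigenvalues is a closed and discrete subset of $\mathbb{C}$, that is, it has no accumulation point in $\mathbb{C}$. -/

import Mathlib

open scoped Distributions Topology ENNReal
open MeasureTheory Filter TopologicalSpace

noncomputable section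

namespace ITP

/-- `D_j f = -i ∂f/∂x_j`. -/
def D {n : ℕ} (j : Fin n) (f : EuclideanSpace ℝ (Fin n) → ℂ) : EuclideanSpace ℝ (Fin n) → ℂ :=
  fun x => -Complex.I * fderiv ℝ f x (EuclideanSpace.single j 1)

/-- `D^α f = D_1^{α_1} ⋯ D_n^{α_n} f` for a multi-index `α`. -/
def multiD {n : ℕ} (α : Fin n → ℕ) (f : EuclideanSpace ℝ (Fin n) → ℂ) :
    EuclideanSpace ℝ (Fin n) → ℂ :=
  (List.finRange n).foldr (fun j g => (D j)^[α j] g) f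

/-- `P(D) f = ∑_α a_α D^α f` for the real polynomial `P(ξ) = ∑_α a_α ξ^α`. -/
def diffOp {n : ℕ} (P : MvPolynomial (Fin n) ℝ) (f : EuclideanSpace ℝ (Fin n) → ℂ) :
    EuclideanSpace ℝ (Fin n) → ℂ :=
  fun x => ∑ α ∈ P.support, ((P.coeff α : ℝ) : ℂ) * multiD α f x

/-- The polynomial `P(-ξ)`; `P(-D)` is the formal transpose of `P(D)`. -/
def reflect {n : ℕ} (P : MvPolynomial (Fin n) ℝ) : MvPolynomial (Fin n) ℝ :=
  MvPolynomial.aeval (fun j => -MvPolynomial.X j) P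

/-- The symbol `ξ ↦ P(ξ)` on `ℝⁿ`. -/
def symbol {n : ℕ} (P : MvPolynomial (Fin n) ℝ) (ξ : EuclideanSpace ℝ (Fin n)) : ℝ :=
  MvPolynomial.eval (fun j => ξ j) P

/-- The polynomial `∂^α P`. -/
def multiDeriv {n : ℕ} (α : Fin n → ℕ) (P : MvPolynomial (Fin n) ℝ) : MvPolynomial (Fin n) ℝ :=
  (List.finRange n).foldr (fun j Q => (MvPolynomial.pderiv j)^[α j] Q) P

/-- `P̃(ξ) = (∑_α |P^{(α)}(ξ)|²)^{1/2}`. The derivatives with some `α_j > deg P` vanish, so the sum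
over all multi-indices is the sum over those with all `α_j ≤ deg P`. -/
def symbolTilde {n : ℕ} (P : MvPolynomial (Fin n) ℝ) (ξ : EuclideanSpace ℝ (Fin n)) : ℝ :=
  Real.sqrt (∑ α : Fin n → Fin (P.totalDegree + 1),
    |symbol (multiDeriv (fun j => (α j : ℕ)) P) ξ| ^ 2)

/-- The support of (the a.e. class of) `f`: the complement of the largest open set on which
`f = 0` almost everywhere. -/
def essSupport {n : ℕ} (f : EuclideanSpace ℝ (Fin n) → ℝ) : Set (EuclideanSpace ℝ (Fin n)) :=
  {x | ∀ U ∈ 𝓝 x, ¬ f =ᵐ[volume.restrict U] 0}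

/-- `f ∈ L²_loc(Ω)`. -/
def MemL2Loc {n : ℕ} (Ω : Opens (EuclideanSpace ℝ (Fin n)))
    (f : EuclideanSpace ℝ (Fin n) → ℂ) : Prop :=
  ∀ K : Set (EuclideanSpace ℝ (Fin n)), IsCompact K → K ⊆ Ω → MemLp f 2 (volume.restrict K)

/-- `(P(D) + q) f = 0` in the sense of distributions on `Ω`, for a function `q`. -/
def WeakSolution {n : ℕ} (Ω : Opens (EuclideanSpace ℝ (Fin n))) (P : MvPolynomial (Fin n) ℝ)
    (q f : EuclideanSpace ℝ (Fin n) → ℂ) : Prop :=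
  ∀ φ : 𝓓(Ω, ℂ), ∫ x in (Ω : Set (EuclideanSpace ℝ (Fin n))),
    f x * (diffOp (reflect P) φ x + q x * φ x) = 0

/-- `u ∈ H_0^P(Ω)`, the completion of `C_0^∞(Ω)` in the norm `‖P(D)φ‖_{L²}`, whose elements are
identified with functions in `L²(Ω)`: the `L²(Ω)`-limits of sequences in `C_0^∞(Ω)` that are Cauchy
in that norm (such sequences are Cauchy in `L²` when `Ω` is bounded and `P ≠ 0`). -/
def MemH0 {n : ℕ} (Ω : Opens (EuclideanSpace ℝ (Fin n))) (P : MvPolynomial (Fin n) ℝ)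
    (u : EuclideanSpace ℝ (Fin n) → ℂ) : Prop :=
  MemLp u 2 (volume.restrict (Ω : Set (EuclideanSpace ℝ (Fin n)))) ∧
  ∃ φ : ℕ → 𝓓(Ω, ℂ),
    Tendsto (fun p : ℕ × ℕ => eLpNorm (diffOp P (φ p.1) - diffOp P (φ p.2)) 2 volume)
      atTop (𝓝 0) ∧
    Tendsto (fun k => eLpNorm (⇑(φ k) - u) 2
      (volume.restrict (Ω : Set (EuclideanSpace ℝ (Fin n))))) atTop (𝓝 0)

/-- `z` is a transmission eigenvalue: there are nonzero `v, w ∈ L²_loc(Ω)` with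
`(P(D) - z) v = 0` and `(P(D) + V - z) w = 0` in `Ω` and `v - w ∈ H_0^P(Ω)`. -/
def IsTransmissionEigenvalue {n : ℕ} (Ω : Opens (EuclideanSpace ℝ (Fin n)))
    (P : MvPolynomial (Fin n) ℝ) (V : EuclideanSpace ℝ (Fin n) → ℝ) (z : ℂ) : Prop :=
  ∃ v w : EuclideanSpace ℝ (Fin n) → ℂ,
    MemL2Loc Ω v ∧ MemL2Loc Ω w ∧
    ¬ v =ᵐ[volume.restrict (Ω : Set (EuclideanSpace ℝ (Fin n)))] 0 ∧
    ¬ w =ᵐ[volume.restrict (Ω : Set (EuclideanSpace ℝ (Fin n)))] 0 ∧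
    WeakSolution Ω P (fun _ => -z) v ∧
    WeakSolution Ω P (fun x => (V x : ℂ) - z) w ∧
    MemH0 Ω P (v - w)

end ITP

end

/-! Put `u = v - w`. Subtracting the two equations gives `(P - z) u = V w` in `Ω`. Since `V ≥ δ`
there, `w = V⁻¹ (P - z) u`, and so `v = V⁻¹ (P - z) u + u`. Testing `(P - z) v = 0` shows that `⟨(P
- z̄) ψ, V⁻¹ (P - z) u + u⟩ = 0` for all test functions `ψ`, and by density for all `ψ` in the
completion. Moreover `u ≠ 0`, as otherwise `w = 0`. It is therefore enough that this form, which is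
a quadratic polynomial in `z`, degenerates for only finitely many `z` in each disk.

Write `p` for the closure of `P(D)`, `j` for the embedding of the completion into `L²`, and `ρ` for
multiplication by `V⁻¹`. Two facts make the form tractable. First, it is coercive at a suitable real
`z = t` because `P` or `-P` is bounded below (`exists_coercive_parameter`), so its leading operator
is invertible. Second, `j` is compact (`isCompactOperator_embed`), so the terms in `μ = z - t` and
`μ²` have compact coefficients. The pencil `S + μ A + μ² B j` linearizes to the eigenvalue problem
of one compact operator with eigenvalue `μ⁻¹` (`finite_singular_of_quadratic_pencil`), and such
eigenvalues can only accumulate at `0`.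

Compactness of `j` rests on Hörmander's inequality `‖P^{(α)}(D) f‖ ≤ C ‖P(D) f‖` for `f` supported
in a fixed ball. It bounds `∫ P̃² |f̂|²`, and `P̃ → ∞` then makes high frequencies uniformly small,
while low frequencies are governed by finitely many Fourier functionals. -/

/-! ### Compact operators on Hilbert spaces -/

section CompactOperators

variable {E F : Type*} [NormedAddCommGroup E] [InnerProductSpace ℂ E]
  [NormedAddCommGroup F] [InnerProductSpace ℂ F]

open InnerProductSpace in
/-- A compact operator has only finitely many eigenvalues outside a ball around the origin. -/
theorem IsCompactOperator.finite_eigenvalues {T : E →L[ℂ] E} (hT : IsCompactOperator T) {r : ℝ}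
    (hr : 0 < r) : {κ : ℂ | r ≤ ‖κ‖ ∧ ∃ x : E, x ≠ 0 ∧ T x = κ • x}.Finite := by
  by_contra hinf
  obtain ⟨κ, hκ⟩ : ∃ κ : ℕ ↪ ℂ, ∀ k, r ≤ ‖κ k‖ ∧ ∃ x : E, x ≠ 0 ∧ T x = κ k • x :=
    ⟨(Set.Infinite.natEmbedding _ hinf).trans (Function.Embedding.subtype _),
      fun k => (Set.Infinite.natEmbedding _ hinf k).2⟩
  choose hκr x hx0 hx using hκ
  have hlin : LinearIndependent ℂ x :=
    Module.End.eigenvectors_linearIndependent' (T : E →ₗ[ℂ] E) κ κ.injective x fun k =>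
      ⟨Module.End.mem_eigenspace_iff.2 (hx k), hx0 k⟩
  set e := gramSchmidtNormed ℂ x with he
  have hon : Orthonormal ℂ e := gramSchmidtNormed_orthonormal hlin
  have hspan : ∀ s : Set ℕ, Submodule.span ℂ (e '' s) = Submodule.span ℂ (gramSchmidt ℂ x '' s) :=
    fun s => span_gramSchmidtNormed x s
  have heIic : ∀ k, e k ∈ Submodule.span ℂ (x '' Set.Iic k) := fun k => by
    rw [← span_gramSchmidt_Iic ℂ x k, ← hspan]
    exact Submodule.subset_span ⟨k, Set.self_mem_Iic, rfl⟩
  have heIio : ∀ {i k}, i < k → e i ∈ Submodule.span ℂ (x '' Set.Iio k) := fun {i k} hik => by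
    rw [← span_gramSchmidt_Iio ℂ x k, ← hspan]
    exact Submodule.subset_span ⟨i, hik, rfl⟩
  have horth : ∀ k, ∀ y ∈ Submodule.span ℂ (x '' Set.Iio k), inner ℂ (e k) y = 0 := by
    intro k y hy
    rw [← span_gramSchmidt_Iio ℂ x k, ← hspan] at hy
    induction hy using Submodule.span_induction with
    | mem y hy =>
      obtain ⟨i, hi, rfl⟩ := hy
      exact hon.2 (ne_of_gt hi)
    | zero => exact inner_zero_right _
    | add y z _ _ h1 h2 => rw [inner_add_right, h1, h2, add_zero]
    | smul a y _ h1 => rw [inner_smul_right, h1, mul_zero]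
  have hinv : ∀ k, ∀ y ∈ Submodule.span ℂ (x '' Set.Iio k),
      T y ∈ Submodule.span ℂ (x '' Set.Iio k) := by
    intro k y hy
    induction hy using Submodule.span_induction with
    | mem y hy =>
      obtain ⟨i, hi, rfl⟩ := hy
      rw [hx]
      exact Submodule.smul_mem _ _ (Submodule.subset_span ⟨i, hi, rfl⟩)
    | zero => simp
    | add y z _ _ h1 h2 => rw [map_add]; exact add_mem h1 h2
    | smul a y _ h1 => rw [map_smul]; exact Submodule.smul_mem _ _ h1
  have hlower : ∀ k, ∀ y ∈ Submodule.span ℂ (x '' Set.Iic k),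
      T y - κ k • y ∈ Submodule.span ℂ (x '' Set.Iio k) := by
    intro k y hy
    induction hy using Submodule.span_induction with
    | mem y hy =>
      obtain ⟨i, hi, rfl⟩ := hy
      rcases (Set.mem_Iic.1 hi).lt_or_eq with h | rfl
      · rw [hx, ← sub_smul]
        exact Submodule.smul_mem _ _ (Submodule.subset_span ⟨i, h, rfl⟩)
      · rw [hx, sub_self]; exact zero_mem _
    | zero => simp
    | add y z _ _ h1 h2 =>
      have := add_mem h1 h2
      rwa [map_add, smul_add, add_sub_add_comm]
    | smul a y _ h1 =>
      have := Submodule.smul_mem _ a h1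
      rwa [map_smul, smul_comm, ← smul_sub]
  -- `T` is triangular in the basis `e`: modulo the span of the earlier vectors `T (e k)` is `κ k •
  -- e k`, and `T (e i)` lies in that span. The component of the difference along `e k` is thus `κ
  -- k`, so the images stay `r` apart and have no convergent subsequence.
  have hsep : ∀ {i k}, i < k → r ≤ ‖T (e k) - T (e i)‖ := by
    intro i k hik
    have h1 : inner ℂ (e k) (T (e k) - T (e i)) = κ k := by
      have h2 := horth k _ (hlower k _ (heIic k))
      have h3 := horth k _ (hinv k _ (heIio hik))
      rw [inner_sub_right, inner_smul_right, inner_self_eq_norm_sq_to_K, hon.1] at h2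
      rw [inner_sub_right, h3, sub_zero, sub_eq_zero.1 h2]
      simp
    calc r ≤ ‖κ k‖ := hκr k
      _ ≤ ‖e k‖ * ‖T (e k) - T (e i)‖ := by rw [← h1]; exact norm_inner_le_norm _ _
      _ = _ := by rw [hon.1, one_mul]
  obtain ⟨K, hK, hTK⟩ := hT.image_closedBall_subset_compact (f := (T : E →ₗ[ℂ] E)) 1
  obtain ⟨a, -, φ, hφ, hlim⟩ := hK.tendsto_subseq (x := fun k => T (e k)) fun k =>
    hTK ⟨e k, by simp [hon.1 k], rfl⟩
  obtain ⟨N, hN⟩ := Metric.cauchySeq_iff.1 hlim.cauchySeq r hr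
  have h := hN (N + 1) (by omega) N le_rfl
  rw [dist_eq_norm] at h
  exact absurd (hsep (hφ (Nat.lt_succ_self N))) (not_le.2 h)

/-- An operator that can be bounded, up to an arbitrarily small multiple of the norm, by finitely
many continuous functionals is compact. -/
theorem isCompactOperator_of_forall_norm_le [CompleteSpace F] (T : E →L[ℂ] F)
    (h : ∀ ε > 0, ∃ (N : ℕ) (l : E →L[ℂ] (Fin N → ℂ)), ∀ x, ‖T x‖ ≤ ε * ‖x‖ + ‖l x‖) :
    IsCompactOperator T := by
  refine (isCompactOperator_iff_isCompact_closure_image_closedBall (T : E →ₗ[ℂ] F)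
    zero_lt_one).2 ?_
  refine TotallyBounded.isCompact_of_isClosed (TotallyBounded.closure ?_) isClosed_closure
  rw [Metric.totallyBounded_iff]
  intro ε hε
  -- Two points of the unit ball differ by at most `2`, so `ε / 4` costs `ε / 2`; the net for `l`
  -- costs the other half.
  obtain ⟨N, l, hl⟩ := h (ε / 4) (by positivity)
  have htb : TotallyBounded (l '' Metric.closedBall 0 1) := by
    have : Bornology.IsBounded (l '' Metric.closedBall 0 1) :=
      (l.lipschitz.isBounded_image Metric.isBounded_closedBall)
    exact (this.isCompact_closure.totallyBounded).subset subset_closure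
  obtain ⟨t, hts, htf, hcov⟩ := Metric.finite_approx_of_totallyBounded htb (ε / 2) (by positivity)
  choose! g hg using fun y (hy : y ∈ t) => hts hy
  refine ⟨(fun y => T (g y)) '' t, htf.image _, ?_⟩
  rintro _ ⟨x, hx, rfl⟩
  obtain ⟨y, hy, hxy⟩ := Set.mem_iUnion₂.1 (hcov ⟨x, hx, rfl⟩)
  refine Set.mem_iUnion₂.2 ⟨T (g y), ⟨y, hy, rfl⟩, ?_⟩
  obtain ⟨hg1, hg2⟩ := hg y hy
  rw [mem_closedBall_zero_iff] at hx hg1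
  rw [Metric.mem_ball, dist_eq_norm] at hxy ⊢
  have h1 := hl (x - g y)
  rw [map_sub, map_sub, hg2] at h1
  have h2 : ‖x - g y‖ ≤ 2 := (norm_sub_le _ _).trans (by linarith)
  change ‖T x - T (g y)‖ < ε
  nlinarith

/-- The adjoint of a compact operator is compact. -/
theorem IsCompactOperator.adjoint [CompleteSpace E] [CompleteSpace F] {T : E →L[ℂ] F}
    (hT : IsCompactOperator T) : IsCompactOperator (ContinuousLinearMap.adjoint T) := by
  set S := ContinuousLinearMap.adjoint T with hS
  have hTS : IsCompactOperator (T ∘L S) := hT.comp_clm S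
  refine (isCompactOperator_iff_isCompact_closure_image_closedBall (S : F →ₗ[ℂ] E)
    zero_lt_one).2 ?_
  refine TotallyBounded.isCompact_of_isClosed (TotallyBounded.closure ?_) isClosed_closure
  rw [Metric.totallyBounded_iff]
  intro ε hε
  have htb : TotallyBounded ((T ∘L S) '' Metric.closedBall 0 1) :=
    ((hTS.isCompact_closure_image_closedBall (f := ((T ∘L S : F →L[ℂ] F) : F →ₗ[ℂ] F))
      1).totallyBounded).subset subset_closure
  -- Since `‖S y‖² = ⟨y, T S y⟩ ≤ 2 ‖T S y‖` for differences `y` of unit ball points, an `ε² /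
  -- 2`-net for `T S` yields an `ε`-net for `S`.
  obtain ⟨t, hts, htf, hcov⟩ := Metric.finite_approx_of_totallyBounded htb (ε ^ 2 / 2)
    (by positivity)
  choose! g hg using fun y (hy : y ∈ t) => hts hy
  refine ⟨(fun y => S (g y)) '' t, htf.image _, ?_⟩
  rintro _ ⟨x, hx, rfl⟩
  obtain ⟨y, hy, hxy⟩ := Set.mem_iUnion₂.1 (hcov ⟨x, hx, rfl⟩)
  refine Set.mem_iUnion₂.2 ⟨S (g y), ⟨y, hy, rfl⟩, ?_⟩
  obtain ⟨hg1, hg2⟩ := hg y hy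
  rw [mem_closedBall_zero_iff] at hx hg1
  rw [Metric.mem_ball, dist_eq_norm] at hxy ⊢
  change ‖S x - S (g y)‖ < ε
  rw [← hg2, ← map_sub] at hxy
  rw [← map_sub]
  have h2 : ‖x - g y‖ ≤ 2 := (norm_sub_le _ _).trans (by linarith)
  have h3 : ‖S (x - g y)‖ ^ 2 ≤ ‖x - g y‖ * ‖T (S (x - g y))‖ := by
    rw [← inner_self_eq_norm_sq (𝕜 := ℂ), hS, ContinuousLinearMap.adjoint_inner_left]
    exact re_inner_le_norm _ _
  have h4 : ‖T (S (x - g y))‖ < ε ^ 2 / 2 := hxy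
  nlinarith [norm_nonneg (S (x - g y)), norm_nonneg (T (S (x - g y)))]

end CompactOperators

/-! ### Quadratic operator pencils and the abstract transmission form. -/

section Pencil

variable {H L : Type*} [NormedAddCommGroup H] [InnerProductSpace ℂ H]
  [NormedAddCommGroup L] [InnerProductSpace ℂ L]

/-- The numbers `μ` of bounded modulus at which a quadratic pencil `S + μ A + μ² B j` with
invertible `S` and compact `A`, `B`, `j` has a kernel are finite in number. -/
theorem finite_singular_of_quadratic_pencil {S A : H →L[ℂ] H} {B : L →L[ℂ] H} {j : H →L[ℂ] L}
    (hS : IsUnit S) (hA : IsCompactOperator A) (hB : IsCompactOperator B)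
    (hj : IsCompactOperator j) (R : ℝ) :
    {μ : ℂ | ‖μ‖ ≤ R ∧ ∃ h : H, h ≠ 0 ∧ S h + μ • A h + μ ^ 2 • B (j h) = 0}.Finite := by
  obtain ⟨S, rfl⟩ := hS
  set Q : H →L[ℂ] H := ((S⁻¹ : (H →L[ℂ] H)ˣ) : H →L[ℂ] H) with hQ
  have hQS : ∀ h, Q ((S : H →L[ℂ] H) h) = h := fun h => by
    exact congrArg (fun T : H →L[ℂ] H => T h) S.inv_mul
  -- Companion linearization: `h = -μ Q A h - μ² Q B j h` says that `(h, μ j h)` is an eigenvector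
  -- of the block operator `(h, g) ↦ (-Q A h - Q B g, j h)` for the eigenvalue `μ⁻¹`. The `L²`
  -- product norm is needed because the eigenvalue theorem is for inner product spaces, and `H × L`
  -- carries the sup norm.
  let W := WithLp.prodContinuousLinearEquiv 2 ℂ H L
  let M₀ : H × L →L[ℂ] H × L :=
    ((-(Q ∘L A)) ∘L ContinuousLinearMap.fst ℂ H L
      - (Q ∘L B) ∘L ContinuousLinearMap.snd ℂ H L).prod (j ∘L ContinuousLinearMap.fst ℂ H L)
  let M : WithLp 2 (H × L) →L[ℂ] WithLp 2 (H × L) :=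
    (W.symm : H × L →L[ℂ] WithLp 2 (H × L)) ∘L M₀ ∘L (W : WithLp 2 (H × L) →L[ℂ] H × L)
  have hM₀ : IsCompactOperator M₀ := by
    have h1 : IsCompactOperator (ContinuousLinearMap.inl ℂ H L ∘ ((-(Q ∘ A)) ∘
        ContinuousLinearMap.fst ℂ H L - (Q ∘ B) ∘ ContinuousLinearMap.snd ℂ H L)) :=
      IsCompactOperator.clm_comp (IsCompactOperator.sub
        (IsCompactOperator.comp_clm (IsCompactOperator.neg (hA.clm_comp Q)) _)
        (IsCompactOperator.comp_clm (hB.clm_comp Q) _)) _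
    have h2 : IsCompactOperator (ContinuousLinearMap.inr ℂ H L ∘ (j ∘
        ContinuousLinearMap.fst ℂ H L)) :=
      IsCompactOperator.clm_comp (IsCompactOperator.comp_clm hj _) _
    have h3 : (M₀ : H × L → H × L) = (ContinuousLinearMap.inl ℂ H L ∘ ((-(Q ∘ A)) ∘
        ContinuousLinearMap.fst ℂ H L - (Q ∘ B) ∘ ContinuousLinearMap.snd ℂ H L)) +
        (ContinuousLinearMap.inr ℂ H L ∘ (j ∘ ContinuousLinearMap.fst ℂ H L)) := by
      funext x
      simp [M₀]
    rw [h3]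
    exact h1.add h2
  have hM : IsCompactOperator M :=
    IsCompactOperator.clm_comp (hM₀.comp_clm (W : WithLp 2 (H × L) →L[ℂ] H × L))
      (W.symm : H × L →L[ℂ] WithLp 2 (H × L))
  have hfin := hM.finite_eigenvalues (r := (max R 1)⁻¹) (by positivity)
  refine ((hfin.image fun κ => κ⁻¹).union (Set.finite_singleton 0)).subset ?_
  rintro μ ⟨hμR, h, hh, heq⟩
  rcases eq_or_ne μ 0 with rfl | hμ
  · exact Or.inr rfl
  refine Or.inl ⟨μ⁻¹, ⟨?_, W.symm (h, μ • j h), ?_, ?_⟩, inv_inv _⟩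
  · rw [norm_inv]
    exact inv_anti₀ (norm_pos_iff.2 hμ) (hμR.trans (le_max_left _ _))
  · intro h0
    have := (W.symm.map_eq_zero_iff).1 h0
    exact hh (congrArg Prod.fst this)
  · have h1 : -(Q (A h)) - μ • Q (B (j h)) = μ⁻¹ • h := by
      have h2 := congrArg Q heq
      rw [map_add, map_add, hQS, map_smul, map_smul, map_zero] at h2
      have h3 : h = -(μ • Q (A h)) - μ ^ 2 • Q (B (j h)) := by
        rw [← sub_eq_zero, ← h2]; abel
      conv_rhs => rw [h3]
      rw [smul_sub, smul_neg, smul_smul, smul_smul, inv_mul_cancel₀ hμ, one_smul, pow_two,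
        ← mul_assoc, inv_mul_cancel₀ hμ, one_mul]
    have h4 : M₀ (h, μ • j h) = μ⁻¹ • (h, μ • j h) := by
      refine Prod.ext ?_ ?_
      · simpa [M₀] using h1
      · simp [M₀, smul_smul, inv_mul_cancel₀ hμ]
    calc M (W.symm (h, μ • j h)) = W.symm (M₀ (h, μ • j h)) := by simp [M]
      _ = _ := by rw [h4, map_smul]

/-- Coercivity of the transmission form at a suitable real spectral parameter. -/
theorem exists_coercive_parameter {p j : H →L[ℂ] L} {ρ : L →L[ℂ] L} {c : ℝ} (hc : 0 < c)
    (hgraph : ∀ h, ‖h‖ ^ 2 ≤ ‖j h‖ ^ 2 + ‖p h‖ ^ 2)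
    (hρ : ∀ f, c * ‖f‖ ^ 2 ≤ (inner ℂ f (ρ f)).re)
    (hbelow : (∃ C : ℝ, ∀ h, C * ‖j h‖ ^ 2 ≤ (inner ℂ (p h) (j h)).re) ∨
      (∃ C : ℝ, ∀ h, C * ‖j h‖ ^ 2 ≤ -(inner ℂ (p h) (j h)).re)) :
    ∃ t a : ℝ, 0 < a ∧ ∀ h, a * ‖h‖ ^ 2 ≤
      (inner ℂ (p h - (t : ℂ) • j h) (ρ (p h - (t : ℂ) • j h) + j h)).re := by
  have hinner : ∀ (t : ℝ) h, (inner ℂ (p h - (t : ℂ) • j h) (j h)).re =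
      (inner ℂ (p h) (j h)).re - t * ‖j h‖ ^ 2 := by
    intro t h
    rw [inner_sub_left, inner_smul_left, Complex.conj_ofReal, Complex.sub_re,
      Complex.re_ofReal_mul, ← RCLike.re_eq_complex_re, inner_self_eq_norm_sq]
  -- With `f = p h - t j h`, control of `‖f‖` and `‖j h‖` also controls `‖p h‖ ≤ ‖f‖ + |t| ‖j h‖`,
  -- hence the graph norm.
  suffices h : ∃ t : ℝ, ∀ h, c / 2 * ‖p h - (t : ℂ) • j h‖ ^ 2 + ‖j h‖ ^ 2 ≤
      (inner ℂ (p h - (t : ℂ) • j h) (ρ (p h - (t : ℂ) • j h) + j h)).re by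
    obtain ⟨t, ht⟩ := h
    refine ⟨t, min (c / 4) (1 / (2 * t ^ 2 + 1)), by positivity, fun h => le_trans ?_ (ht h)⟩
    set a := min (c / 4) (1 / (2 * t ^ 2 + 1)) with ha
    have ha0 : 0 < a := by positivity
    have ha1 : a ≤ c / 4 := min_le_left _ _
    have ha2 : a * (2 * t ^ 2 + 1) ≤ 1 := by
      rw [← le_div_iff₀ (by positivity)]; exact min_le_right _ _
    set f := p h - (t : ℂ) • j h with hf
    have h1 : ‖p h‖ ≤ ‖f‖ + |t| * ‖j h‖ := by
      have : p h = f + (t : ℂ) • j h := by rw [hf]; abel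
      rw [this]
      refine (norm_add_le _ _).trans ?_
      rw [norm_smul, Complex.norm_real, Real.norm_eq_abs]
    have h2 : ‖p h‖ ^ 2 ≤ 2 * ‖f‖ ^ 2 + 2 * t ^ 2 * ‖j h‖ ^ 2 := by
      calc ‖p h‖ ^ 2 ≤ (‖f‖ + |t| * ‖j h‖) ^ 2 := by gcongr
        _ ≤ 2 * (‖f‖ ^ 2 + (|t| * ‖j h‖) ^ 2) := add_sq_le
        _ = _ := by rw [mul_pow, sq_abs]; ring
    calc a * ‖h‖ ^ 2 ≤ a * (‖j h‖ ^ 2 + (2 * ‖f‖ ^ 2 + 2 * t ^ 2 * ‖j h‖ ^ 2)) := by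
          gcongr; exact (hgraph h).trans (by linarith)
      _ = 2 * a * ‖f‖ ^ 2 + a * (2 * t ^ 2 + 1) * ‖j h‖ ^ 2 := by ring
      _ ≤ 2 * (c / 4) * ‖f‖ ^ 2 + 1 * ‖j h‖ ^ 2 := by gcongr
      _ = _ := by ring
  rcases hbelow with ⟨C, hC⟩ | ⟨C, hC⟩
  -- Below the lower bound of `P` the cross term `⟨f, j h⟩` is itself at least `‖j h‖²`.
  · refine ⟨C - 1, fun h => ?_⟩
    rw [inner_add_right, Complex.add_re, hinner]
    have h1 := hρ (p h - ((C - 1 : ℝ) : ℂ) • j h)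
    have h2 := hC h
    nlinarith [sq_nonneg ‖p h - ((C - 1 : ℝ) : ℂ) • j h‖]
  -- Here the cross term is negative. For large `t`, however, it forces `‖f‖` to be large compared
  -- with `‖j h‖`, so that `c ‖f‖²` absorbs it by Cauchy–Schwarz and Young; the summand `2 / c` pays
  -- for Young and `1` is what remains.
  · refine ⟨-C + 2 / c + 1, fun h => ?_⟩
    set t := -C + 2 / c + 1 with ht
    set f := p h - (t : ℂ) • j h with hf
    have h1 := hρ f
    have h2 := hC h
    have h3 : -(inner ℂ f (j h)).re ≤ ‖f‖ * ‖j h‖ := by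
      have := re_inner_le_norm (𝕜 := ℂ) (-f) (j h)
      rwa [inner_neg_left, map_neg, norm_neg] at this
    have h4 : (2 / c + 1) * ‖j h‖ ^ 2 ≤ -(inner ℂ f (j h)).re := by
      rw [hinner]
      have : (2 / c + 1) = C + t := by rw [ht]; ring
      rw [this]; linarith
    have h5 : 2 * (‖f‖ * ‖j h‖) ≤ c / 2 * ‖f‖ ^ 2 + 2 / c * ‖j h‖ ^ 2 := by
      have : c / 2 * ‖f‖ ^ 2 + 2 / c * ‖j h‖ ^ 2 - 2 * (‖f‖ * ‖j h‖) =
          2 / c * (c / 2 * ‖f‖ - ‖j h‖) ^ 2 := by field_simp; ring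
      have : 0 ≤ 2 / c * (c / 2 * ‖f‖ - ‖j h‖) ^ 2 := by positivity
      linarith
    rw [inner_add_right, Complex.add_re]
    linarith

/-- The transmission form `⟨(p - z̄ j) k, ρ (p - z j) h + j h⟩` is degenerate for only finitely many
`z` in each disk. -/
theorem finite_degenerate_transmission_form [CompleteSpace H] [CompleteSpace L]
    {p j : H →L[ℂ] L} {ρ : L →L[ℂ] L} {c : ℝ} (hc : 0 < c)
    (hj : IsCompactOperator j) (hgraph : ∀ h, ‖h‖ ^ 2 ≤ ‖j h‖ ^ 2 + ‖p h‖ ^ 2)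
    (hρ : ∀ f, c * ‖f‖ ^ 2 ≤ (inner ℂ f (ρ f)).re)
    (hbelow : (∃ C : ℝ, ∀ h, C * ‖j h‖ ^ 2 ≤ (inner ℂ (p h) (j h)).re) ∨
      (∃ C : ℝ, ∀ h, C * ‖j h‖ ^ 2 ≤ -(inner ℂ (p h) (j h)).re)) (R : ℝ) :
    {z : ℂ | ‖z‖ ≤ R ∧ ∃ h : H, h ≠ 0 ∧ ∀ k : H,
      inner ℂ (p k - (starRingEnd ℂ z) • j k) (ρ (p h - z • j h) + j h) = 0}.Finite := by
  obtain ⟨t, a, ha, hcoer⟩ := exists_coercive_parameter hc hgraph hρ hbelow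
  let q : H →L[ℂ] L := p - (t : ℂ) • j
  have hq : ∀ h, q h = p h - (t : ℂ) • j h := fun h => rfl
  let q' := ContinuousLinearMap.adjoint q
  let j' := ContinuousLinearMap.adjoint j
  have hj' : IsCompactOperator j' := hj.adjoint
  -- With `μ = z - t` the form is `⟨k, S h + μ A h + μ² j' ρ j h⟩`. The conjugate on `z` in the left
  -- slot makes it polynomial in `μ`. Coercivity makes `S` invertible, and every other term contains
  -- `j` or its adjoint.
  let S : H →L[ℂ] H := q' ∘L (ρ ∘L q + j)
  let A : H →L[ℂ] H := -(j' ∘L (ρ ∘L q + j) + (q' ∘L ρ) ∘L j)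
  have hS : IsUnit S := by
    refine ContinuousLinearMap.isUnit_of_forall_le_norm_inner_map S (c := ⟨a, ha.le⟩) ha
      fun h => ?_
    have h1 : inner ℂ h (S h) = inner ℂ (q h) (ρ (q h) + j h) :=
      ContinuousLinearMap.adjoint_inner_right q h _
    rw [norm_inner_symm, h1, mul_comm]
    exact (hcoer h).trans ((Complex.re_le_norm _))
  have hA : IsCompactOperator A := by
    have h1 : IsCompactOperator (-((j' ∘ (ρ ∘L q + j : H →L[ℂ] L)) + (q' ∘L ρ : L →L[ℂ] H) ∘ j)) :=
      ((hj'.comp_clm _).add (hj.clm_comp (q' ∘L ρ))).neg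
    exact h1
  have hB : IsCompactOperator (j' ∘L ρ) := hj'.comp_clm ρ
  refine ((finite_singular_of_quadratic_pencil hS hA hB hj (R + |t|)).image
    fun μ => (t : ℂ) + μ).subset ?_
  rintro z ⟨hz, h, hh, hform⟩
  refine ⟨z - t, ⟨?_, h, hh, ?_⟩, by simp⟩
  · refine (norm_sub_le _ _).trans ?_
    rw [Complex.norm_real, Real.norm_eq_abs]
    linarith
  · refine ext_inner_left ℂ fun k => ?_
    rw [inner_zero_right, ← hform k]
    set μ := z - (t : ℂ) with hμ
    have hzμ : z = t + μ := by rw [hμ]; ring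
    have e1 : ∀ h, p h - z • j h = q h - μ • j h := fun h => by
      rw [hq, hzμ, add_smul]; abel
    have e2 : p k - (starRingEnd ℂ z) • j k = q k - (starRingEnd ℂ μ) • j k := by
      rw [hq, hzμ, map_add, Complex.conj_ofReal, add_smul]; abel
    have eS : inner ℂ k (S h) = inner ℂ (q k) (ρ (q h) + j h) :=
      ContinuousLinearMap.adjoint_inner_right q k _
    have eA : inner ℂ k (A h) =
        -(inner ℂ (j k) (ρ (q h) + j h) + inner ℂ (q k) (ρ (j h))) := by
      change inner ℂ k (-(j' (ρ (q h) + j h) + q' (ρ (j h)))) = _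
      rw [inner_neg_right, inner_add_right, ContinuousLinearMap.adjoint_inner_right,
        ContinuousLinearMap.adjoint_inner_right]
    have eB : inner ℂ k ((j' ∘L ρ) (j h)) = inner ℂ (j k) (ρ (j h)) :=
      ContinuousLinearMap.adjoint_inner_right j k _
    rw [inner_add_right, inner_add_right, inner_smul_right, inner_smul_right, eS, eA, eB, e1, e2]
    simp only [inner_add_right, inner_sub_left, inner_sub_right, inner_smul_left, inner_smul_right,
      map_sub, map_smul, Complex.conj_conj]
    ring

/-- A set of complex numbers that meets each disk in a finite set is closed and discrete. -/
theorem isClosed_and_isDiscrete_of_finite_inter_closedBall {s : Set ℂ}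
    (h : ∀ R : ℝ, {z | ‖z‖ ≤ R ∧ z ∈ s}.Finite) : IsClosed s ∧ IsDiscrete s := by
  rw [isClosed_and_discrete_iff]
  intro x
  have hfin := h (‖x‖ + 1)
  -- The disk of radius `‖x‖ + 1` contains the unit ball about `x`, so near `x` only finitely many
  -- points of `s` need be avoided.
  have h1 : ({z | ‖z‖ ≤ ‖x‖ + 1 ∧ z ∈ s} \ {x})ᶜ ∈ 𝓝 x :=
    (hfin.sdiff.isClosed.isOpen_compl).mem_nhds (by simp)
  rw [Filter.disjoint_principal_right, mem_nhdsWithin_iff_eventually]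
  filter_upwards [h1, Metric.ball_mem_nhds x one_pos] with z hz hzx hne hzs
  refine hz ⟨⟨?_, hzs⟩, hne⟩
  have h2 : ‖z - x‖ < 1 := by simpa [dist_eq_norm] using hzx
  have h3 := norm_add_le (z - x) x
  rw [sub_add_cancel] at h3
  linarith

end Pencil

/-! ### Constant coefficient operators on Schwartz functions -/

noncomputable section

namespace ITP

open SchwartzMap FourierTransform LineDeriv
open scoped SchwartzMap Real

variable {n : ℕ}

@[fun_prop]
theorem hasTemperateGrowth_coord (j : Fin n) :
    Function.HasTemperateGrowth fun x : EuclideanSpace ℝ (Fin n) => x j :=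
  (EuclideanSpace.proj (𝕜 := ℝ) j).hasTemperateGrowth

@[fun_prop]
theorem hasTemperateGrowth_symbol (Q : MvPolynomial (Fin n) ℝ) :
    Function.HasTemperateGrowth (symbol Q) := by
  induction Q using MvPolynomial.induction_on with
  | C a =>
    have : symbol (MvPolynomial.C a : MvPolynomial (Fin n) ℝ) = fun _ => a := by
      funext ξ; simp [symbol]
    rw [this]; exact Function.HasTemperateGrowth.const a
  | add p q hp hq =>
    have : symbol (p + q) = symbol p + symbol q := by
      funext ξ; simp [symbol]
    rw [this]; exact hp.add hq
  | mul_X p j hp =>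
    have : symbol (p * MvPolynomial.X j) = symbol p * fun ξ => ξ j := by
      funext ξ; simp [symbol]
    rw [this]; exact hp.mul (hasTemperateGrowth_coord j)

/-- The Fourier multiplier of `Q(D)` in the normalization `e^{-2πi x·ξ}`. -/
def multiplier (Q : MvPolynomial (Fin n) ℝ) (ξ : EuclideanSpace ℝ (Fin n)) : ℂ :=
  ((symbol Q ((2 * π) • ξ) : ℝ) : ℂ)

@[fun_prop]
theorem hasTemperateGrowth_multiplier (Q : MvPolynomial (Fin n) ℝ) :
    Function.HasTemperateGrowth (multiplier Q) := by
  have h : Function.HasTemperateGrowth fun ξ : EuclideanSpace ℝ (Fin n) => (2 * π) • ξ := by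
    fun_prop
  exact Function.Complex.hasTemperateGrowth_ofReal.comp ((hasTemperateGrowth_symbol Q).comp h)

/-- The operator `Q(D)` on Schwartz functions. -/
def opD (Q : MvPolynomial (Fin n) ℝ) :
    𝓢(EuclideanSpace ℝ (Fin n), ℂ) →L[ℂ] 𝓢(EuclideanSpace ℝ (Fin n), ℂ) :=
  fourierMultiplierCLM ℂ (multiplier Q)

theorem fourier_opD (Q : MvPolynomial (Fin n) ℝ) (f : 𝓢(EuclideanSpace ℝ (Fin n), ℂ))
    (ξ : EuclideanSpace ℝ (Fin n)) : 𝓕 (opD Q f) ξ = multiplier Q ξ * 𝓕 f ξ := by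
  rw [opD, fourierMultiplierCLM_apply, fourier_fourierInv_eq,
    smulLeftCLM_apply_apply (hasTemperateGrowth_multiplier Q), smul_eq_mul]

theorem ext_fourier {f g : 𝓢(EuclideanSpace ℝ (Fin n), ℂ)} (h : ∀ ξ, 𝓕 f ξ = 𝓕 g ξ) : f = g := by
  have : 𝓕 f = 𝓕 g := SchwartzMap.ext h
  have h1 : 𝓕⁻ (𝓕 f) = f := fourierInv_fourier_eq f
  rw [← h1, this]
  exact fourierInv_fourier_eq g

theorem opD_add (Q R : MvPolynomial (Fin n) ℝ) (f : 𝓢(EuclideanSpace ℝ (Fin n), ℂ)) :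
    opD (Q + R) f = opD Q f + opD R f :=
  ext_fourier fun ξ => by
    rw [FourierTransform.fourier_add, add_apply, fourier_opD, fourier_opD, fourier_opD]
    simp [multiplier, symbol, add_mul]

theorem opD_mul (Q R : MvPolynomial (Fin n) ℝ) (f : 𝓢(EuclideanSpace ℝ (Fin n), ℂ)) :
    opD (Q * R) f = opD Q (opD R f) :=
  ext_fourier fun ξ => by
    rw [fourier_opD, fourier_opD, fourier_opD]
    simp [multiplier, symbol, mul_assoc]

theorem opD_C (a : ℝ) (f : 𝓢(EuclideanSpace ℝ (Fin n), ℂ)) :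
    opD (MvPolynomial.C a) f = (a : ℂ) • f :=
  ext_fourier fun ξ => by
    rw [fourier_opD, FourierTransform.fourier_smul, smul_apply]
    simp [multiplier, symbol]

theorem opD_one (f : 𝓢(EuclideanSpace ℝ (Fin n), ℂ)) : opD 1 f = f := by
  rw [← MvPolynomial.C_1, opD_C, Complex.ofReal_one, one_smul]

theorem opD_zero (f : 𝓢(EuclideanSpace ℝ (Fin n), ℂ)) : opD 0 f = 0 := by
  rw [← MvPolynomial.C_0, opD_C, Complex.ofReal_zero, zero_smul]

theorem opD_sum {ι : Type*} (s : Finset ι) (Q : ι → MvPolynomial (Fin n) ℝ)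
    (f : 𝓢(EuclideanSpace ℝ (Fin n), ℂ)) : opD (∑ i ∈ s, Q i) f = ∑ i ∈ s, opD (Q i) f := by
  classical
  induction s using Finset.induction_on with
  | empty => simp [opD_zero]
  | insert i s hi ih => rw [Finset.sum_insert hi, Finset.sum_insert hi, opD_add, ih]

theorem opD_X (j : Fin n) (f : 𝓢(EuclideanSpace ℝ (Fin n), ℂ)) :
    opD (MvPolynomial.X j) f = -Complex.I • ∂_{(EuclideanSpace.single j (1 : ℝ))} f :=
  ext_fourier fun ξ => by
    rw [fourier_opD, FourierTransform.fourier_smul, smul_apply,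
      fourier_lineDerivOp_eq, smul_apply,
      smulLeftCLM_apply_apply (by fun_prop)]
    simp [multiplier, symbol, EuclideanSpace.inner_single_right]
    linear_combination (2 * π * ξ j * 𝓕 f ξ) * Complex.I_mul_I

theorem opD_X_apply (j : Fin n) (f : 𝓢(EuclideanSpace ℝ (Fin n), ℂ)) :
    ⇑(opD (MvPolynomial.X j) f) = D j f := by
  funext x
  rw [opD_X, smul_apply, lineDerivOp_apply_eq_fderiv, D, smul_eq_mul]

theorem iterate_D (j : Fin n) (a : ℕ) (f : 𝓢(EuclideanSpace ℝ (Fin n), ℂ)) :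
    (D j)^[a] f = ⇑(opD (MvPolynomial.X j ^ a) f) := by
  induction a with
  | zero => simp [opD_one]
  | succ a ih => rw [Function.iterate_succ_apply', ih, pow_succ', opD_mul, opD_X_apply]

theorem multiD_eq_opD (α : Fin n →₀ ℕ) (f : 𝓢(EuclideanSpace ℝ (Fin n), ℂ)) :
    multiD α f = ⇑(opD (MvPolynomial.monomial α 1) f) := by
  have h : ∀ l : List (Fin n), l.foldr (fun j g => (D j)^[α j] g) f =
      ⇑(opD ((l.map fun j => MvPolynomial.X j ^ α j).prod) f) := by
    intro l
    induction l with
    | nil => simp [opD_one]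
    | cons j l ih => rw [List.foldr_cons, ih, iterate_D, List.map_cons, List.prod_cons, opD_mul]
  rw [multiD, h, MvPolynomial.monomial_eq, MvPolynomial.C_1, one_mul,
    Finsupp.prod_fintype _ _ (fun i => pow_zero _), ← List.prod_ofFn, List.ofFn_eq_map]

/-- Links the classical operator of the statement to its Fourier multiplier, where composition is
multiplication of polynomials and all `Q(D)` visibly commute. -/
theorem diffOp_eq_opD (Q : MvPolynomial (Fin n) ℝ) (f : 𝓢(EuclideanSpace ℝ (Fin n), ℂ)) :
    diffOp Q f = ⇑(opD Q f) := by
  funext x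
  conv_rhs => rw [Q.as_sum, opD_sum]
  rw [diffOp, sum_apply]
  refine Finset.sum_congr rfl fun α _ => ?_
  rw [multiD_eq_opD, ← mul_one (Q.coeff α), ← MvPolynomial.C_mul_monomial, opD_mul, opD_C,
    smul_apply, smul_eq_mul, mul_one]

/-- Multiplication by the coordinate `x_k`. -/
def coordMul (k : Fin n) :
    𝓢(EuclideanSpace ℝ (Fin n), ℂ) →L[ℂ] 𝓢(EuclideanSpace ℝ (Fin n), ℂ) :=
  smulLeftCLM ℂ fun x => ((x k : ℝ) : ℂ)

theorem coordMul_apply (k : Fin n) (f : 𝓢(EuclideanSpace ℝ (Fin n), ℂ))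
    (x : EuclideanSpace ℝ (Fin n)) : coordMul k f x = ((x k : ℝ) : ℂ) * f x := by
  rw [coordMul, smulLeftCLM_apply_apply (by fun_prop), smul_eq_mul]

/-- The canonical commutation relation, written with `pderiv` so that it is the inductive step for
general polynomials. -/
theorem D_coordMul (j k : Fin n) (f : 𝓢(EuclideanSpace ℝ (Fin n), ℂ)) :
    opD (MvPolynomial.X j) (coordMul k f) =
      coordMul k (opD (MvPolynomial.X j) f) -
        Complex.I • opD (MvPolynomial.pderiv k (MvPolynomial.X j)) f := by
  classical
  ext x
  have hf : (coordMul k f : EuclideanSpace ℝ (Fin n) → ℂ) = fun x => ((x k : ℝ) : ℂ) * f x :=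
    funext (coordMul_apply k f)
  have h1 : HasFDerivAt (fun x : EuclideanSpace ℝ (Fin n) => ((x k : ℝ) : ℂ))
      (Complex.ofRealCLM ∘L EuclideanSpace.proj (𝕜 := ℝ) k) x :=
    (Complex.ofRealCLM ∘L EuclideanSpace.proj (𝕜 := ℝ) k).hasFDerivAt
  rw [opD_X_apply, sub_apply, smul_apply, coordMul_apply, opD_X_apply, D, D,
    hf, (h1.fun_mul (f.hasFDerivAt x)).fderiv, MvPolynomial.pderiv_X]
  rcases eq_or_ne j k with rfl | hjk
  · simp [opD_one]; ring
  · simp [opD_zero, hjk, hjk.symm]; ring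

/-- The commutator of `Q(D)` with multiplication by `x_k` is `-i (∂_k Q)(D)`. -/
theorem opD_coordMul (Q : MvPolynomial (Fin n) ℝ) (k : Fin n)
    (f : 𝓢(EuclideanSpace ℝ (Fin n), ℂ)) :
    opD Q (coordMul k f) =
      coordMul k (opD Q f) - Complex.I • opD (MvPolynomial.pderiv k Q) f := by
  induction Q using MvPolynomial.induction_on generalizing f with
  | C a => simp [opD_C, opD_zero]
  | add p q hp hq =>
    rw [opD_add, hp, hq, opD_add, map_add, map_add, opD_add, smul_add]; abel
  | mul_X p j hp =>
    rw [opD_mul, D_coordMul, map_sub, map_smul, hp, opD_mul, MvPolynomial.pderiv_mul, opD_add,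
      opD_mul, opD_mul, smul_add, sub_sub]

/-- Locality is invisible in the Fourier definition; it comes from building `Q` out of first
derivatives. -/
theorem tsupport_opD_subset (Q : MvPolynomial (Fin n) ℝ) (f : 𝓢(EuclideanSpace ℝ (Fin n), ℂ)) :
    tsupport (opD Q f) ⊆ tsupport f := by
  induction Q using MvPolynomial.induction_on generalizing f with
  | C a =>
    rw [opD_C]
    exact closure_mono (Function.support_const_smul_subset (a : ℂ) f)
  | add p q hp hq =>
    rw [opD_add]
    exact (tsupport_add _ _).trans (Set.union_subset (hp f) (hq f))
  | mul_X p j hp =>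
    rw [opD_mul]
    refine (hp _).trans ?_
    rw [opD_X]
    exact (closure_mono (Function.support_const_smul_subset (-Complex.I) _)).trans
      (tsupport_lineDerivOp_subset _ f)

/-- The class of a Schwartz function in `L²`. -/
def toL2 : 𝓢(EuclideanSpace ℝ (Fin n), ℂ) →L[ℂ]
    Lp ℂ 2 (volume : Measure (EuclideanSpace ℝ (Fin n))) :=
  toLpCLM ℂ ℂ 2 volume

theorem coeFn_toL2 (f : 𝓢(EuclideanSpace ℝ (Fin n), ℂ)) : toL2 f =ᵐ[volume] f :=
  f.coeFn_toLp 2 volume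

theorem inner_toL2 (f g : 𝓢(EuclideanSpace ℝ (Fin n), ℂ)) :
    inner ℂ (toL2 f) (toL2 g) = ∫ x, inner ℂ (f x) (g x) :=
  inner_toL2_toL2_eq f g volume

theorem inner_toL2_fourier (f g : 𝓢(EuclideanSpace ℝ (Fin n), ℂ)) :
    inner ℂ (toL2 (𝓕 f)) (toL2 (𝓕 g)) = inner ℂ (toL2 f) (toL2 g) :=
  inner_fourier_toL2_eq f g

/-- `Q` has real coefficients, so its multiplier is real and Plancherel gives symmetry. -/
theorem inner_opD_left (Q : MvPolynomial (Fin n) ℝ) (f g : 𝓢(EuclideanSpace ℝ (Fin n), ℂ)) :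
    inner ℂ (toL2 (opD Q f)) (toL2 g) = inner ℂ (toL2 f) (toL2 (opD Q g)) := by
  rw [← inner_toL2_fourier, ← inner_toL2_fourier (f := f), inner_toL2, inner_toL2]
  refine integral_congr_ae (ae_of_all _ fun ξ => ?_)
  simp only [fourier_opD, RCLike.inner_apply, multiplier, map_mul, Complex.conj_ofReal]
  ring

/-! ### Hörmander's inequality by commutators with the coordinates. -/

theorem norm_toLp_coordMul_le {A : ℝ} (k : Fin n) {f : 𝓢(EuclideanSpace ℝ (Fin n), ℂ)}
    (hf : tsupport f ⊆ Metric.closedBall 0 A) :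
    ‖toL2 (coordMul k f)‖ ≤ A * ‖toL2 f‖ := by
  refine Lp.norm_le_mul_norm_of_ae_le_mul ?_
  filter_upwards [coeFn_toL2 (coordMul k f), coeFn_toL2 f] with x h1 h2
  rw [h1, h2, coordMul_apply, norm_mul, Complex.norm_real]
  by_cases hx : x ∈ tsupport f
  · gcongr
    exact (PiLp.norm_apply_le x k).trans (mem_closedBall_zero_iff.1 (hf hx))
  · rw [image_eq_zero_of_notMem_tsupport hx]; simp

/-- Write one factor `Q'(D) f` as a commutator of `Q(D)` with `x_k`. In the term where `Q(D)` acts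
on `x_k f`, symmetry and commutativity exchange the two operators, so that `Q(D)` falls on `f` and
`Q'(D)` on `x_k f`; a second commutator then produces `Q''`. On the support of `f`, `|x_k| ≤ A`. -/
theorem norm_opD_pderiv_sq_le {A : ℝ} (Q : MvPolynomial (Fin n) ℝ) (k : Fin n)
    {f : 𝓢(EuclideanSpace ℝ (Fin n), ℂ)} (hf : tsupport f ⊆ Metric.closedBall 0 A) :
    ‖toL2 (opD (MvPolynomial.pderiv k Q) f)‖ ^ 2 ≤
      (2 * A * ‖toL2 (opD (MvPolynomial.pderiv k Q) f)‖ +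
        ‖toL2 (opD (MvPolynomial.pderiv k (MvPolynomial.pderiv k Q)) f)‖) *
        ‖toL2 (opD Q f)‖ := by
  set Q' := MvPolynomial.pderiv k Q with hQ'
  set Q'' := MvPolynomial.pderiv k Q' with hQ''
  have h1 : Complex.I • toL2 (opD Q' f) =
      toL2 (coordMul k (opD Q f)) - toL2 (opD Q (coordMul k f)) := by
    rw [opD_coordMul, map_sub, map_smul]; abel
  have h2 : inner ℂ (toL2 (opD Q' f)) (toL2 (opD Q (coordMul k f))) =
      inner ℂ (toL2 (opD Q f))
        (toL2 (coordMul k (opD Q' f)) - Complex.I • toL2 (opD Q'' f)) := by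
    rw [inner_opD_left, ← opD_mul, mul_comm, opD_mul, ← inner_opD_left, opD_coordMul, map_sub,
      map_smul]
  have h3 : Complex.I * inner ℂ (toL2 (opD Q' f)) (toL2 (opD Q' f)) =
      inner ℂ (toL2 (opD Q' f)) (toL2 (coordMul k (opD Q f))) -
      inner ℂ (toL2 (opD Q f))
        (toL2 (coordMul k (opD Q' f)) - Complex.I • toL2 (opD Q'' f)) := by
    rw [← inner_smul_right, h1, inner_sub_right, h2]
  have h4 : ‖toL2 (opD Q' f)‖ ^ 2 =
      ‖Complex.I * inner ℂ (toL2 (opD Q' f)) (toL2 (opD Q' f))‖ := by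
    rw [norm_mul, Complex.norm_I, one_mul, inner_self_eq_norm_sq_to_K, norm_pow]
    simp
  have h5 := norm_toLp_coordMul_le k ((tsupport_opD_subset Q f).trans hf)
  have h6 := norm_toLp_coordMul_le k ((tsupport_opD_subset Q' f).trans hf)
  rw [h4, h3]
  refine (norm_sub_le _ _).trans ?_
  have h7 := norm_inner_le_norm (𝕜 := ℂ) (toL2 (opD Q' f)) (toL2 (coordMul k (opD Q f)))
  have h8 := norm_inner_le_norm (𝕜 := ℂ) (toL2 (opD Q f))
    (toL2 (coordMul k (opD Q' f)) - Complex.I • toL2 (opD Q'' f))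
  have h9 := norm_sub_le (toL2 (coordMul k (opD Q' f))) (Complex.I • toL2 (opD Q'' f))
  rw [norm_smul, Complex.norm_I, one_mul] at h9
  have h10 := mul_le_mul_of_nonneg_left h5 (norm_nonneg (toL2 (opD Q' f)))
  have h11 := mul_le_mul_of_nonneg_left (h9.trans (add_le_add_left h6 _))
    (norm_nonneg (toL2 (opD Q f)))
  linarith

/-- Induction on the degree in `x_k`: the bound of `Q''` by `Q'` turns the quadratic estimate into
`a² ≤ 2 A (N + 1) a b`, and one factor `a` cancels. -/
theorem norm_opD_pderiv_le_of_iterate_eq_zero {A : ℝ} (hA : 0 ≤ A) (k : Fin n) (N : ℕ)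
    (Q : MvPolynomial (Fin n) ℝ) (hQ : (MvPolynomial.pderiv k)^[N + 1] Q = 0)
    {f : 𝓢(EuclideanSpace ℝ (Fin n), ℂ)} (hf : tsupport f ⊆ Metric.closedBall 0 A) :
    ‖toL2 (opD (MvPolynomial.pderiv k Q) f)‖ ≤ 2 * A * N * ‖toL2 (opD Q f)‖ := by
  induction N generalizing Q with
  | zero =>
    have h0 : MvPolynomial.pderiv k Q = 0 := hQ
    rw [h0, opD_zero, map_zero]; simp
  | succ N ih =>
    have h1 := ih (MvPolynomial.pderiv k Q) (by rwa [Function.iterate_succ_apply] at hQ)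
    have h2 := norm_opD_pderiv_sq_le Q k hf
    set a := ‖toL2 (opD (MvPolynomial.pderiv k Q) f)‖ with ha
    set b := ‖toL2 (opD Q f)‖ with hb
    have ha0 : 0 ≤ a := norm_nonneg _
    have hb0 : 0 ≤ b := norm_nonneg _
    rcases ha0.eq_or_lt with h0 | h0
    · rw [← h0]; positivity
    · refine le_of_mul_le_mul_left ?_ h0
      calc a * a = a ^ 2 := (sq a).symm
        _ ≤ _ := h2
        _ ≤ (2 * A * a + 2 * A * N * a) * b := by gcongr
        _ = _ := by push_cast; ring

theorem iterate_pderiv_eq_zero {σ : Type*} (k : σ) (N : ℕ) (Q : MvPolynomial σ ℝ)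
    (hQ : ∀ m : σ →₀ ℕ, N ≤ m k → Q.coeff m = 0) : (MvPolynomial.pderiv k)^[N] Q = 0 := by
  induction N generalizing Q with
  | zero => exact MvPolynomial.ext _ _ fun m => by simpa using hQ m (Nat.zero_le _)
  | succ N ih =>
    rw [Function.iterate_succ_apply]
    refine ih _ fun m hm => ?_
    rw [MvPolynomial.coeff_pderiv, hQ _ (by simpa using hm), zero_mul]

theorem exists_norm_opD_pderiv_le {A : ℝ} (hA : 0 ≤ A) (k : Fin n) (Q : MvPolynomial (Fin n) ℝ) :
    ∃ C : ℝ, 0 ≤ C ∧ ∀ f : 𝓢(EuclideanSpace ℝ (Fin n), ℂ), tsupport f ⊆ Metric.closedBall 0 A →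
      ‖toL2 (opD (MvPolynomial.pderiv k Q) f)‖ ≤ C * ‖toL2 (opD Q f)‖ := by
  refine ⟨2 * A * (Q.degreeOf k : ℕ), by positivity, fun f hf =>
    norm_opD_pderiv_le_of_iterate_eq_zero hA k _ Q (iterate_pderiv_eq_zero k _ Q fun m hm => ?_) hf⟩
  by_contra h
  exact absurd (MvPolynomial.monomial_le_degreeOf k (MvPolynomial.mem_support_iff.2 h)) (by omega)

/-- Hörmander's inequality. -/
theorem exists_norm_opD_multiDeriv_le {A : ℝ} (hA : 0 ≤ A) (α : Fin n → ℕ)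
    (Q : MvPolynomial (Fin n) ℝ) :
    ∃ C : ℝ, 0 ≤ C ∧ ∀ f : 𝓢(EuclideanSpace ℝ (Fin n), ℂ), tsupport f ⊆ Metric.closedBall 0 A →
      ‖toL2 (opD (multiDeriv α Q) f)‖ ≤ C * ‖toL2 (opD Q f)‖ := by
  have hiter : ∀ (k : Fin n) (a : ℕ) (R : MvPolynomial (Fin n) ℝ), ∃ C : ℝ, 0 ≤ C ∧
      ∀ f : 𝓢(EuclideanSpace ℝ (Fin n), ℂ), tsupport f ⊆ Metric.closedBall 0 A →
        ‖toL2 (opD ((MvPolynomial.pderiv k)^[a] R) f)‖ ≤ C * ‖toL2 (opD R f)‖ := by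
    intro k a R
    induction a with
    | zero => exact ⟨1, zero_le_one, fun f _ => by simp⟩
    | succ a ih =>
      obtain ⟨C, hC, h⟩ := ih
      obtain ⟨C', hC', h'⟩ := exists_norm_opD_pderiv_le hA k ((MvPolynomial.pderiv k)^[a] R)
      refine ⟨C' * C, by positivity, fun f hf => ?_⟩
      rw [Function.iterate_succ_apply', mul_assoc]
      exact (h' f hf).trans (mul_le_mul_of_nonneg_left (h f hf) hC')
  have hfold : ∀ l : List (Fin n), ∃ C : ℝ, 0 ≤ C ∧
      ∀ f : 𝓢(EuclideanSpace ℝ (Fin n), ℂ), tsupport f ⊆ Metric.closedBall 0 A →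
        ‖toL2 (opD (l.foldr (fun j R => (MvPolynomial.pderiv j)^[α j] R) Q) f)‖ ≤
          C * ‖toL2 (opD Q f)‖ := by
    intro l
    induction l with
    | nil => exact ⟨1, zero_le_one, fun f _ => by simp⟩
    | cons j l ih =>
      obtain ⟨C, hC, h⟩ := ih
      obtain ⟨C', hC', h'⟩ := hiter j (α j)
        (l.foldr (fun j R => (MvPolynomial.pderiv j)^[α j] R) Q)
      refine ⟨C' * C, by positivity, fun f hf => ?_⟩
      rw [List.foldr_cons, mul_assoc]
      exact (h' f hf).trans (mul_le_mul_of_nonneg_left (h f hf) hC')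
  exact hfold _

end ITP

end

/-! ### The compactness estimate -/

noncomputable section

namespace ITP

open SchwartzMap FourierTransform
open scoped SchwartzMap Real

variable {n : ℕ}

theorem norm_toL2_sq (f : 𝓢(EuclideanSpace ℝ (Fin n), ℂ)) :
    ‖toL2 f‖ ^ 2 = ∫ ξ, ‖𝓕 f ξ‖ ^ 2 := by
  rw [integral_norm_sq_fourier]
  have h1 := inner_toL2 f f
  rw [inner_self_eq_norm_sq_to_K] at h1
  have h2 : ∫ x, inner ℂ (f x) (f x) = ((∫ x, ‖f x‖ ^ 2 : ℝ) : ℂ) := by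
    rw [← integral_complex_ofReal]
    refine integral_congr_ae (ae_of_all _ fun x => ?_)
    simp only [inner_self_eq_norm_sq_to_K]
    push_cast; rfl
  rw [h2] at h1
  refine Complex.ofReal_injective (Eq.trans ?_ h1)
  push_cast; rfl

theorem integrable_norm_fourier_sq (f : 𝓢(EuclideanSpace ℝ (Fin n), ℂ)) :
    Integrable fun ξ => ‖𝓕 f ξ‖ ^ 2 :=
  (memLp_two_iff_integrable_sq_norm (𝓕 f).continuous.aestronglyMeasurable).1 ((𝓕 f).memLp 2)

theorem norm_fourier_opD_sq (Q : MvPolynomial (Fin n) ℝ) (f : 𝓢(EuclideanSpace ℝ (Fin n), ℂ))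
    (ξ : EuclideanSpace ℝ (Fin n)) :
    ‖𝓕 (opD Q f) ξ‖ ^ 2 = |symbol Q ((2 * π) • ξ)| ^ 2 * ‖𝓕 f ξ‖ ^ 2 := by
  rw [fourier_opD, norm_mul, mul_pow, multiplier, Complex.norm_real, Real.norm_eq_abs]

theorem symbolTilde_sq (P : MvPolynomial (Fin n) ℝ) (ξ : EuclideanSpace ℝ (Fin n)) :
    symbolTilde P ξ ^ 2 = ∑ α : Fin n → Fin (P.totalDegree + 1),
      |symbol (multiDeriv (fun j => (α j : ℕ)) P) ξ| ^ 2 :=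
  Real.sq_sqrt (Finset.sum_nonneg fun _ _ => by positivity)

/-- By Plancherel the integral is the sum over `α` of `‖P^{(α)}(D) f‖²`, and Hörmander's inequality
bounds each term. -/
theorem exists_integral_symbolTilde_le {A : ℝ} (hA : 0 ≤ A) (P : MvPolynomial (Fin n) ℝ) :
    ∃ C : ℝ, 0 ≤ C ∧ ∀ f : 𝓢(EuclideanSpace ℝ (Fin n), ℂ), tsupport f ⊆ Metric.closedBall 0 A →
      Integrable (fun ξ => symbolTilde P ((2 * π) • ξ) ^ 2 * ‖𝓕 f ξ‖ ^ 2) ∧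
      ∫ ξ, symbolTilde P ((2 * π) • ξ) ^ 2 * ‖𝓕 f ξ‖ ^ 2 ≤ C ^ 2 * ‖toL2 (opD P f)‖ ^ 2 := by
  choose C hC0 hC using fun α : Fin n → Fin (P.totalDegree + 1) =>
    exists_norm_opD_multiDeriv_le hA (fun j => (α j : ℕ)) P
  refine ⟨Real.sqrt (∑ α, C α ^ 2), Real.sqrt_nonneg _, fun f hf => ?_⟩
  have heq : (fun ξ => symbolTilde P ((2 * π) • ξ) ^ 2 * ‖𝓕 f ξ‖ ^ 2) = fun ξ =>
      ∑ α : Fin n → Fin (P.totalDegree + 1),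
        ‖𝓕 (opD (multiDeriv (fun j => (α j : ℕ)) P) f) ξ‖ ^ 2 := by
    funext ξ
    rw [symbolTilde_sq, Finset.sum_mul]
    exact Finset.sum_congr rfl fun α _ => (norm_fourier_opD_sq _ f ξ).symm
  rw [heq]
  refine ⟨integrable_finsetSum _ fun α _ => integrable_norm_fourier_sq _, ?_⟩
  rw [integral_finsetSum _ fun α _ => integrable_norm_fourier_sq _,
    Real.sq_sqrt (Finset.sum_nonneg fun _ _ => by positivity), Finset.sum_mul]
  refine Finset.sum_le_sum fun α _ => ?_
  rw [← norm_toL2_sq, ← mul_pow]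
  exact pow_le_pow_left₀ (norm_nonneg _) (hC α f hf) 2

/-- The plane wave `e^{2πi x·ξ}` cut off to the ball of radius `A`, as a function. -/
def cutoffWaveFun (A : ℝ) (ξ : EuclideanSpace ℝ (Fin n)) : EuclideanSpace ℝ (Fin n) → ℂ :=
  (Metric.closedBall 0 A).indicator fun x =>
    Complex.exp (Complex.I * ((2 * π * inner ℝ x ξ : ℝ) : ℂ))

theorem memLp_cutoffWaveFun (A : ℝ) (ξ : EuclideanSpace ℝ (Fin n)) :
    MemLp (cutoffWaveFun A ξ) 2 volume := by
  refine (memLp_indicator_iff_restrict measurableSet_closedBall).2 ?_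
  have : IsFiniteMeasure (volume.restrict (Metric.closedBall (0 : EuclideanSpace ℝ (Fin n)) A)) :=
    ⟨by simpa using measure_closedBall_lt_top⟩
  refine MemLp.of_bound (Continuous.aestronglyMeasurable (by fun_prop)) 1 (ae_of_all _ fun x => ?_)
  rw [mul_comm, Complex.norm_exp_ofReal_mul_I]

/-- The plane wave `e^{2πi x·ξ}` cut off to the ball of radius `A`, in `L²`. -/
def cutoffWave (A : ℝ) (ξ : EuclideanSpace ℝ (Fin n)) :
    Lp ℂ 2 (volume : Measure (EuclideanSpace ℝ (Fin n))) :=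
  (memLp_cutoffWaveFun A ξ).toLp _

/-- The cutoff is invisible to functions supported in the ball, and it makes point evaluation of the
Fourier transform a bounded functional on `L²`. -/
theorem inner_cutoffWave {A : ℝ} {f : 𝓢(EuclideanSpace ℝ (Fin n), ℂ)}
    (hf : tsupport f ⊆ Metric.closedBall 0 A) (ξ : EuclideanSpace ℝ (Fin n)) :
    inner ℂ (cutoffWave A ξ) (toL2 f) = 𝓕 f ξ := by
  rw [L2.inner_def, fourier_coe, Real.fourier_eq']
  refine integral_congr_ae ?_
  filter_upwards [(memLp_cutoffWaveFun A ξ).coeFn_toLp, coeFn_toL2 f] with x h1 h2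
  rw [cutoffWave, h1, h2, RCLike.inner_apply, cutoffWaveFun]
  by_cases hx : x ∈ tsupport f
  · rw [Set.indicator_of_mem (hf hx), ← Complex.exp_conj, smul_eq_mul, mul_comm]
    congr 2
    rw [map_mul, Complex.conj_I, Complex.conj_ofReal]
    push_cast; ring
  · rw [image_eq_zero_of_notMem_tsupport hx]; simp

theorem norm_cutoffWave_sub_le {A : ℝ} (ξ η : EuclideanSpace ℝ (Fin n)) :
    ‖cutoffWave A ξ - cutoffWave A η‖ ≤
      2 * π * A * ‖ξ - η‖ * ‖cutoffWave A (0 : EuclideanSpace ℝ (Fin n))‖ := by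
  refine Lp.norm_le_mul_norm_of_ae_le_mul ?_
  filter_upwards [Lp.coeFn_sub (cutoffWave A ξ) (cutoffWave A η),
    (memLp_cutoffWaveFun A ξ).coeFn_toLp, (memLp_cutoffWaveFun A η).coeFn_toLp,
    (memLp_cutoffWaveFun A (0 : EuclideanSpace ℝ (Fin n))).coeFn_toLp] with x h1 h2 h3 h4
  rw [h1, Pi.sub_apply, cutoffWave, cutoffWave, cutoffWave, h2, h3, h4]
  simp only [cutoffWaveFun]
  by_cases hx : x ∈ Metric.closedBall (0 : EuclideanSpace ℝ (Fin n)) A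
  · rw [Set.indicator_of_mem hx, Set.indicator_of_mem hx, Set.indicator_of_mem hx]
    have h5 : Complex.exp (Complex.I * ((2 * π * inner ℝ x ξ : ℝ) : ℂ)) -
        Complex.exp (Complex.I * ((2 * π * inner ℝ x η : ℝ) : ℂ)) =
        Complex.exp (Complex.I * ((2 * π * inner ℝ x η : ℝ) : ℂ)) *
          (Complex.exp (Complex.I * ((2 * π * inner ℝ x (ξ - η) : ℝ) : ℂ)) - 1) := by
      rw [mul_sub, ← Complex.exp_add, mul_one, inner_sub_right]
      congr 2
      push_cast; ring
    rw [h5, norm_mul, mul_comm Complex.I, Complex.norm_exp_ofReal_mul_I, one_mul]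
    refine Real.norm_exp_I_mul_ofReal_sub_one_le.trans ?_
    have h6 := abs_real_inner_le_norm x (ξ - η)
    rw [mem_closedBall_zero_iff] at hx
    have h7 : ‖x‖ * ‖ξ - η‖ ≤ A * ‖ξ - η‖ := by gcongr
    rw [norm_mul, Real.norm_eq_abs (inner ℝ _ _), Real.norm_of_nonneg (by positivity)]
    simp only [inner_zero_right, mul_zero, Complex.ofReal_zero, Complex.exp_zero, norm_one, mul_one]
    nlinarith [Real.pi_pos]
  · simp [Set.indicator_of_notMem hx]

theorem continuous_cutoffWave (A : ℝ) :
    Continuous (cutoffWave A : EuclideanSpace ℝ (Fin n) → _) := by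
  refine (LipschitzWith.of_dist_le_mul (K := Real.toNNReal
    (2 * π * |A| * ‖cutoffWave A (0 : EuclideanSpace ℝ (Fin n))‖)) fun ξ η => ?_).continuous
  rw [dist_eq_norm, dist_eq_norm, Real.coe_toNNReal _ (by positivity)]
  refine (norm_cutoffWave_sub_le ξ η).trans ?_
  calc 2 * π * A * ‖ξ - η‖ * ‖cutoffWave A (0 : EuclideanSpace ℝ (Fin n))‖
      ≤ 2 * π * |A| * ‖ξ - η‖ * ‖cutoffWave A (0 : EuclideanSpace ℝ (Fin n))‖ := by
        gcongr; exact le_abs_self A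
    _ = _ := by ring

theorem exists_radius_symbolTilde {P : MvPolynomial (Fin n) ℝ}
    (hP : Tendsto (symbolTilde P) (cocompact (EuclideanSpace ℝ (Fin n))) atTop) (M : ℝ) :
    ∃ R : ℝ, 0 ≤ R ∧ ∀ ξ, R < ‖ξ‖ → M ≤ symbolTilde P ((2 * π) • ξ) := by
  have h := hP.eventually_ge_atTop M
  obtain ⟨K, hK, hKs⟩ := mem_cocompact.1 h
  obtain ⟨R, hR⟩ := hK.isBounded.subset_closedBall 0
  refine ⟨|R|, abs_nonneg R, fun ξ hξ => ?_⟩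
  by_contra hlt
  have h1 := hR (not_not.1 fun hξK => hlt (hKs hξK))
  rw [mem_closedBall_zero_iff, norm_smul, Real.norm_of_nonneg (by positivity)] at h1
  have h2 : 1 ≤ 2 * π := by linarith [Real.pi_gt_three]
  nlinarith [le_abs_self R, norm_nonneg ξ]

/-- The compactness estimate for the embedding of the completion of test functions in the norm
`‖P(D) f‖` into `L²`. -/
theorem exists_norm_toL2_le {A : ℝ} (hA : 0 ≤ A) {P : MvPolynomial (Fin n) ℝ}
    (hP : Tendsto (symbolTilde P) (cocompact (EuclideanSpace ℝ (Fin n))) atTop) {ε : ℝ}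
    (hε : 0 < ε) :
    ∃ (N : ℕ) (l : Lp ℂ 2 (volume : Measure (EuclideanSpace ℝ (Fin n))) →L[ℂ] (Fin N → ℂ)),
      ∀ f : 𝓢(EuclideanSpace ℝ (Fin n), ℂ), tsupport f ⊆ Metric.closedBall 0 A →
        ‖toL2 f‖ ≤ ε * (‖toL2 f‖ + ‖toL2 (opD P f)‖) + ‖l (toL2 f)‖ := by
  obtain ⟨C, hC0, hC⟩ := exists_integral_symbolTilde_le hA P
  -- Beyond `R` the weight `P̃` exceeds `(C + 1) / ε`, which beats Hörmander's constant `C`; the `+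
  -- 1` avoids division by zero.
  obtain ⟨R, hR0, hR⟩ := exists_radius_symbolTilde hP ((C + 1) / ε)
  set B : Set (EuclideanSpace ℝ (Fin n)) := Metric.closedBall 0 R with hB
  set b : ℝ := Real.sqrt (volume.real B) with hb
  have hb0 : 0 ≤ b := Real.sqrt_nonneg _
  have htb : TotallyBounded (cutoffWave A '' B) :=
    ((isCompact_closedBall 0 R).image (continuous_cutoffWave A)).totallyBounded
  -- The waves with frequency in `B` form a compact set, so finitely many of them determine the
  -- Fourier transform on `B` up to a small multiple of `‖f‖`. The radius allows for the factor `b`,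
  -- the root of the volume of `B`, lost in integrating.
  obtain ⟨t, hts, htf, hcov⟩ := Metric.finite_approx_of_totallyBounded htb (ε / (b + 1))
    (by positivity)
  have := htf.fintype
  let g : Fin (Fintype.card t) → Lp ℂ 2 (volume : Measure (EuclideanSpace ℝ (Fin n))) :=
    fun i => (Fintype.equivFin t).symm i
  let l₀ : Lp ℂ 2 (volume : Measure (EuclideanSpace ℝ (Fin n))) →L[ℂ]
      (Fin (Fintype.card t) → ℂ) := ContinuousLinearMap.pi fun i => innerSL ℂ (g i)
  refine ⟨Fintype.card t, (b : ℂ) • l₀, fun f hf => ?_⟩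
  set m : ℝ := ‖l₀ (toL2 f)‖ + ε / (b + 1) * ‖toL2 f‖ with hm
  have hm0 : 0 ≤ m := by positivity
  have hsup : ∀ ξ ∈ B, ‖𝓕 f ξ‖ ≤ m := by
    intro ξ hξ
    obtain ⟨y, hy, hξy⟩ := Set.mem_iUnion₂.1 (hcov ⟨ξ, hξ, rfl⟩)
    rw [Metric.mem_ball, dist_eq_norm] at hξy
    rw [← inner_cutoffWave hf ξ]
    have h1 : inner ℂ (cutoffWave A ξ) (toL2 f) =
        inner ℂ y (toL2 f) + inner ℂ (cutoffWave A ξ - y) (toL2 f) := by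
      rw [← inner_add_left]; congr 1; abel
    rw [h1]
    refine (norm_add_le _ _).trans (add_le_add ?_ ?_)
    · have h2 := norm_le_pi_norm (l₀ (toL2 f)) (Fintype.equivFin t ⟨y, hy⟩)
      simpa [l₀, g] using h2
    · refine (norm_inner_le_norm _ _).trans ?_
      gcongr
  have hint := integrable_norm_fourier_sq f
  have hlow : ∫ ξ in B, ‖𝓕 f ξ‖ ^ 2 ≤ (b * m) ^ 2 := by
    have h1 : ∫ ξ in B, ‖𝓕 f ξ‖ ^ 2 ≤ ∫ _ in B, m ^ 2 :=
      setIntegral_mono_on hint.integrableOn (integrableOn_const measure_closedBall_lt_top.ne)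
        measurableSet_closedBall fun ξ hξ => pow_le_pow_left₀ (norm_nonneg _) (hsup ξ hξ) 2
    rw [setIntegral_const, smul_eq_mul] at h1
    rwa [mul_pow, hb, Real.sq_sqrt measureReal_nonneg]
  have hhigh : ∫ ξ in Bᶜ, ‖𝓕 f ξ‖ ^ 2 ≤ (ε * ‖toL2 (opD P f)‖) ^ 2 := by
    obtain ⟨hi, hle⟩ := hC f hf
    have h1 : ∫ ξ in Bᶜ, ‖𝓕 f ξ‖ ^ 2 ≤ ∫ ξ in Bᶜ, (ε / (C + 1)) ^ 2 *
        (symbolTilde P ((2 * π) • ξ) ^ 2 * ‖𝓕 f ξ‖ ^ 2) := by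
      refine setIntegral_mono_on hint.integrableOn (hi.const_mul _).integrableOn
        measurableSet_closedBall.compl fun ξ hξ => ?_
      rw [← mul_assoc, ← mul_pow]
      refine le_mul_of_one_le_left (by positivity) (one_le_pow₀ ?_)
      have h2 := hR ξ (by simpa [hB] using hξ)
      calc (1 : ℝ) = ε / (C + 1) * ((C + 1) / ε) := by field_simp
        _ ≤ _ := by gcongr
    have h3 : ∫ ξ in Bᶜ, (ε / (C + 1)) ^ 2 *
        (symbolTilde P ((2 * π) • ξ) ^ 2 * ‖𝓕 f ξ‖ ^ 2) ≤ ∫ ξ, (ε / (C + 1)) ^ 2 *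
        (symbolTilde P ((2 * π) • ξ) ^ 2 * ‖𝓕 f ξ‖ ^ 2) :=
      setIntegral_le_integral (hi.const_mul _) (ae_of_all _ fun ξ => by positivity)
    rw [integral_const_mul (r := (ε / (C + 1)) ^ 2) (μ := volume)] at h3
    calc ∫ ξ in Bᶜ, ‖𝓕 f ξ‖ ^ 2
        ≤ (ε / (C + 1)) ^ 2 * (C ^ 2 * ‖toL2 (opD P f)‖ ^ 2) := by
          refine (h1.trans h3).trans ?_
          gcongr
      _ = (ε * (C / (C + 1)) * ‖toL2 (opD P f)‖) ^ 2 := by field_simp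
      _ ≤ (ε * 1 * ‖toL2 (opD P f)‖) ^ 2 := by
          have : C / (C + 1) ≤ 1 := (div_le_one (by positivity)).2 (by linarith)
          gcongr
      _ = _ := by ring
  have hsq : ‖toL2 f‖ ^ 2 ≤ (b * m + ε * ‖toL2 (opD P f)‖) ^ 2 := by
    rw [norm_toL2_sq, ← integral_add_compl measurableSet_closedBall hint (s := B)]
    have : 0 ≤ b * m * (ε * ‖toL2 (opD P f)‖) := by positivity
    nlinarith
  have hfin := le_of_sq_le_sq hsq (by positivity)
  have hbm : b * m ≤ b * ‖l₀ (toL2 f)‖ + ε * ‖toL2 f‖ := by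
    have : b * (ε / (b + 1)) ≤ ε := by
      rw [← mul_div_assoc, div_le_iff₀ (by positivity)]; nlinarith
    rw [hm, mul_add, ← mul_assoc]
    gcongr
  have hl : ‖((b : ℂ) • l₀) (toL2 f)‖ = b * ‖l₀ (toL2 f)‖ := by
    rw [smul_apply, norm_smul, Complex.norm_real, Real.norm_of_nonneg hb0]
  rw [hl]
  linarith

end ITP

end

/-! ### The completion of the test functions in the graph norm -/

noncomputable section

namespace ITP

open SchwartzMap FourierTransform
open scoped SchwartzMap Real

variable {n : ℕ} {Ω : Opens (EuclideanSpace ℝ (Fin n))}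

/-- Test functions are Schwartz functions. -/
def toSchwartz : 𝓓(Ω, ℂ) →ₗ[ℂ] 𝓢(EuclideanSpace ℝ (Fin n), ℂ) where
  toFun φ := φ.hasCompactSupport.toSchwartzMap φ.contDiff
  map_add' _ _ := rfl
  map_smul' _ _ := rfl

@[simp]
theorem coe_toSchwartz (φ : 𝓓(Ω, ℂ)) : ⇑(toSchwartz φ) = φ := rfl

theorem diffOp_testFunction (Q : MvPolynomial (Fin n) ℝ) (φ : 𝓓(Ω, ℂ)) :
    diffOp Q φ = ⇑(opD Q (toSchwartz φ)) := by
  rw [← diffOp_eq_opD, coe_toSchwartz]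

/-- The Hilbert space `L²(ℝⁿ)`. -/
abbrev L2 (n : ℕ) : Type := Lp ℂ 2 (volume : Measure (EuclideanSpace ℝ (Fin n)))

/-- The graph `φ ↦ (φ, P(D) φ)` of `P(D)` on test functions. -/
def graphMap (Ω : Opens (EuclideanSpace ℝ (Fin n))) (P : MvPolynomial (Fin n) ℝ) :
    𝓓(Ω, ℂ) →ₗ[ℂ] WithLp 2 (L2 n × L2 n) where
  toFun φ := WithLp.toLp 2 (toL2 (toSchwartz φ), toL2 (opD P (toSchwartz φ)))
  map_add' φ ψ := by
    rw [map_add, map_add, map_add, map_add, ← WithLp.toLp_add, Prod.mk_add_mk]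
  map_smul' c φ := by
    rw [map_smul, map_smul, map_smul, map_smul, ← Prod.smul_mk, WithLp.toLp_smul, RingHom.id_apply]

/-- The completion of the test functions in the graph norm of `P(D)`. -/
def graphSpace (Ω : Opens (EuclideanSpace ℝ (Fin n))) (P : MvPolynomial (Fin n) ℝ) :
    Submodule ℂ (WithLp 2 (L2 n × L2 n)) :=
  (LinearMap.range (graphMap Ω P)).topologicalClosure

instance (P : MvPolynomial (Fin n) ℝ) : CompleteSpace (graphSpace Ω P) :=
  (Submodule.isClosed_topologicalClosure _).completeSpace_coe

/-- The embedding `u ↦ u` into `L²`. -/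
def embed (Ω : Opens (EuclideanSpace ℝ (Fin n))) (P : MvPolynomial (Fin n) ℝ) :
    graphSpace Ω P →L[ℂ] L2 n :=
  WithLp.fstL 2 ℂ (L2 n) (L2 n) ∘L (graphSpace Ω P).subtypeL

/-- The closure of `P(D)`. -/
def closedOp (Ω : Opens (EuclideanSpace ℝ (Fin n))) (P : MvPolynomial (Fin n) ℝ) :
    graphSpace Ω P →L[ℂ] L2 n :=
  WithLp.sndL 2 ℂ (L2 n) (L2 n) ∘L (graphSpace Ω P).subtypeL

/-- A test function as an element of the completion. -/
def ofTest (P : MvPolynomial (Fin n) ℝ) (φ : 𝓓(Ω, ℂ)) : graphSpace Ω P :=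
  ⟨graphMap Ω P φ, Submodule.le_topologicalClosure _ ⟨φ, rfl⟩⟩

theorem embed_ofTest (P : MvPolynomial (Fin n) ℝ) (φ : 𝓓(Ω, ℂ)) :
    embed Ω P (ofTest P φ) = toL2 (toSchwartz φ) := rfl

theorem closedOp_ofTest (P : MvPolynomial (Fin n) ℝ) (φ : 𝓓(Ω, ℂ)) :
    closedOp Ω P (ofTest P φ) = toL2 (opD P (toSchwartz φ)) := rfl

theorem denseRange_ofTest (P : MvPolynomial (Fin n) ℝ) :
    DenseRange (ofTest P : 𝓓(Ω, ℂ) → graphSpace Ω P) := by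
  intro h
  rw [Topology.IsInducing.subtypeVal.closure_eq_preimage_closure_image, Set.mem_preimage,
    ← Set.range_comp]
  exact h.2

theorem norm_sq_graphSpace (P : MvPolynomial (Fin n) ℝ) (h : graphSpace Ω P) :
    ‖h‖ ^ 2 = ‖embed Ω P h‖ ^ 2 + ‖closedOp Ω P h‖ ^ 2 :=
  WithLp.prod_norm_sq_eq_of_L2 (h : WithLp 2 (L2 n × L2 n))

/-- The estimate for test functions involves only continuous quantities, so it passes to the
completion by density. -/
theorem isCompactOperator_embed (hΩ : Bornology.IsBounded (Ω : Set (EuclideanSpace ℝ (Fin n))))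
    {P : MvPolynomial (Fin n) ℝ}
    (hP : Tendsto (symbolTilde P) (cocompact (EuclideanSpace ℝ (Fin n))) atTop) :
    IsCompactOperator (embed Ω P) := by
  obtain ⟨A, hA⟩ := hΩ.subset_closedBall 0
  have hA' : (Ω : Set (EuclideanSpace ℝ (Fin n))) ⊆ Metric.closedBall 0 |A| :=
    hA.trans (Metric.closedBall_subset_closedBall (le_abs_self A))
  refine isCompactOperator_of_forall_norm_le _ fun ε hε => ?_
  obtain ⟨N, l, hl⟩ := exists_norm_toL2_le (abs_nonneg A) hP (half_pos hε)
  refine ⟨N, l ∘L embed Ω P, fun h => ?_⟩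
  have h1 : ‖embed Ω P h‖ ≤ ε / 2 * (‖embed Ω P h‖ + ‖closedOp Ω P h‖) + ‖l (embed Ω P h)‖ := by
    refine (denseRange_ofTest P).induction_on (p := fun h => ‖embed Ω P h‖ ≤
      ε / 2 * (‖embed Ω P h‖ + ‖closedOp Ω P h‖) + ‖l (embed Ω P h)‖) h
      (isClosed_le (by fun_prop) (by fun_prop)) fun φ => ?_
    rw [embed_ofTest, closedOp_ofTest]
    exact hl _ (φ.tsupport_subset.trans hA')
  have h2 := norm_sq_graphSpace P h
  have h3 : ‖embed Ω P h‖ ≤ ‖h‖ :=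
    le_of_sq_le_sq (by rw [h2]; linarith [sq_nonneg ‖closedOp Ω P h‖]) (norm_nonneg h)
  have h4 : ‖closedOp Ω P h‖ ≤ ‖h‖ :=
    le_of_sq_le_sq (by rw [h2]; linarith [sq_nonneg ‖embed Ω P h‖]) (norm_nonneg h)
  refine h1.trans (add_le_add_left ?_ _)
  calc ε / 2 * (‖embed Ω P h‖ + ‖closedOp Ω P h‖) ≤ ε / 2 * (‖h‖ + ‖h‖) := by gcongr
    _ = ε * ‖h‖ := by ring

/-! ### Semiboundedness of `P(D)` on the completion. -/

theorem integrable_symbol_mul (Q : MvPolynomial (Fin n) ℝ)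
    (f : 𝓢(EuclideanSpace ℝ (Fin n), ℂ)) :
    Integrable fun ξ => symbol Q ((2 * π) • ξ) * ‖𝓕 f ξ‖ ^ 2 := by
  have h : Integrable fun ξ => inner ℂ (𝓕 f ξ) (𝓕 (opD Q f) ξ) :=
    (MeasureTheory.L2.integrable_inner (𝕜 := ℂ) (toL2 (𝓕 f)) (toL2 (𝓕 (opD Q f)))).congr (by
      filter_upwards [coeFn_toL2 (𝓕 f), coeFn_toL2 (𝓕 (opD Q f))] with ξ h1 h2
      rw [h1, h2])
  refine h.re.congr (ae_of_all _ fun ξ => ?_)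
  simp only [fourier_opD, multiplier, RCLike.inner_apply]
  rw [mul_assoc, Complex.mul_conj, ← Complex.ofReal_mul, Complex.normSq_eq_norm_sq]
  exact Complex.ofReal_re _

theorem re_inner_opD (Q : MvPolynomial (Fin n) ℝ) (f : 𝓢(EuclideanSpace ℝ (Fin n), ℂ)) :
    (inner ℂ (toL2 (opD Q f)) (toL2 f)).re = ∫ ξ, symbol Q ((2 * π) • ξ) * ‖𝓕 f ξ‖ ^ 2 := by
  rw [inner_opD_left, ← inner_toL2_fourier, inner_toL2, ← Complex.ofReal_re (∫ ξ, _),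
    ← integral_complex_ofReal]
  congr 1
  refine integral_congr_ae (ae_of_all _ fun ξ => ?_)
  simp only [fourier_opD, multiplier, RCLike.inner_apply]
  rw [mul_assoc, Complex.mul_conj, Complex.normSq_eq_norm_sq, Complex.ofReal_mul]

/-- By Plancherel the form of `P(D)` is the integral of the symbol against `|f̂|²`, so pointwise
bounds on the symbol become form bounds. -/
theorem exists_le_re_inner {P : MvPolynomial (Fin n) ℝ}
    (hP : (∃ C : ℝ, ∀ ξ, C ≤ symbol P ξ) ∨ (∃ C : ℝ, ∀ ξ, C ≤ -symbol P ξ)) :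
    (∃ C : ℝ, ∀ h, C * ‖embed Ω P h‖ ^ 2 ≤ (inner ℂ (closedOp Ω P h) (embed Ω P h)).re) ∨
      (∃ C : ℝ, ∀ h, C * ‖embed Ω P h‖ ^ 2 ≤ -(inner ℂ (closedOp Ω P h) (embed Ω P h)).re) := by
  refine hP.imp ?_ ?_
  all_goals
    rintro ⟨C, hC⟩
    refine ⟨C, fun h => ?_⟩
  · refine (denseRange_ofTest P).induction_on (p := fun h => C * ‖embed Ω P h‖ ^ 2 ≤
      (inner ℂ (closedOp Ω P h) (embed Ω P h)).re) h (isClosed_le (by fun_prop) (by fun_prop))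
      fun φ => ?_
    rw [embed_ofTest, closedOp_ofTest, re_inner_opD, norm_toL2_sq, ← integral_const_mul]
    refine integral_mono ((integrable_norm_fourier_sq _).const_mul _) (integrable_symbol_mul P _)
      fun ξ => ?_
    exact mul_le_mul_of_nonneg_right (hC _) (by positivity)
  · refine (denseRange_ofTest P).induction_on (p := fun h => C * ‖embed Ω P h‖ ^ 2 ≤
      -(inner ℂ (closedOp Ω P h) (embed Ω P h)).re) h (isClosed_le (by fun_prop) (by fun_prop))
      fun φ => ?_
    rw [embed_ofTest, closedOp_ofTest, re_inner_opD, norm_toL2_sq, ← integral_const_mul,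
      ← integral_neg]
    refine integral_mono ((integrable_norm_fourier_sq _).const_mul _)
      (integrable_symbol_mul P _).neg fun ξ => ?_
    have := mul_le_mul_of_nonneg_right (hC ((2 * π) • ξ))
      (show 0 ≤ ‖𝓕 (toSchwartz φ) ξ‖ ^ 2 by positivity)
    simpa only [neg_mul] using this

/-! ### Multiplication operators -/

/-- Multiplication by a bounded function on `L²`. -/
def mulL2 {r : EuclideanSpace ℝ (Fin n) → ℂ} (hr : MemLp r ∞ volume) :
    L2 n →L[ℂ]
      L2 n :=
  (ContinuousLinearMap.mul ℂ ℂ).holderL volume ∞ 2 2 (hr.toLp r)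

theorem coeFn_mulL2 {r : EuclideanSpace ℝ (Fin n) → ℂ} (hr : MemLp r ∞ volume)
    (f : L2 n) :
    mulL2 hr f =ᵐ[volume] fun x => r x * f x := by
  have h := (ContinuousLinearMap.mul ℂ ℂ).coeFn_holder (r := 2) (hr.toLp r) f
  filter_upwards [h, hr.coeFn_toLp] with x h1 h2
  rw [← h2]
  exact h1

theorem le_re_inner_mulL2 {r : EuclideanSpace ℝ (Fin n) → ℝ} {c : ℝ}
    (hr : MemLp (fun x => (r x : ℂ)) ∞ volume) (hc : ∀ᵐ x, c ≤ r x)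
    (f : L2 n) :
    c * ‖f‖ ^ 2 ≤ (inner ℂ f (mulL2 hr f)).re := by
  have hn : ‖f‖ ^ 2 = ∫ x, ‖f x‖ ^ 2 := by
    rw [← inner_self_eq_norm_sq (𝕜 := ℂ), MeasureTheory.L2.inner_def,
      ← integral_re (MeasureTheory.L2.integrable_inner f f)]
    simp only [inner_self_eq_norm_sq]
  have h1 : Integrable fun x => ‖f x‖ ^ 2 :=
    (memLp_two_iff_integrable_sq_norm (Lp.aestronglyMeasurable f)).1 (Lp.memLp f)
  have h2 := (MeasureTheory.L2.integrable_inner (𝕜 := ℂ) f (mulL2 hr f))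
  rw [hn, ← integral_const_mul, MeasureTheory.L2.inner_def, ← RCLike.re_eq_complex_re,
    ← integral_re h2]
  refine integral_mono_ae (h1.const_mul c) h2.re ?_
  filter_upwards [hc, coeFn_mulL2 hr f] with x hx hm
  rw [hm, RCLike.inner_apply, mul_assoc, Complex.mul_conj, Complex.normSq_eq_norm_sq,
    ← Complex.ofReal_mul]
  exact (mul_le_mul_of_nonneg_right hx (by positivity)).trans (Complex.ofReal_re _).ge

end ITP

end

/-! ### Reduction of the transmission problem to the form -/

noncomputable section

namespace ITP

open SchwartzMap LineDeriv
open scoped SchwartzMap ComplexConjugate ContDiff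

variable {n : ℕ} {Ω : Opens (EuclideanSpace ℝ (Fin n))}

/-- Complex conjugation of Schwartz functions. -/
def conjSchwartz : 𝓢(EuclideanSpace ℝ (Fin n), ℂ) →L[ℝ] 𝓢(EuclideanSpace ℝ (Fin n), ℂ) :=
  postcompCLM (Complex.conjCLE : ℂ →L[ℝ] ℂ)

theorem conjSchwartz_apply (f : 𝓢(EuclideanSpace ℝ (Fin n), ℂ)) (x : EuclideanSpace ℝ (Fin n)) :
    conjSchwartz f x = conj (f x) := rfl

theorem conjSchwartz_smul (c : ℂ) (f : 𝓢(EuclideanSpace ℝ (Fin n), ℂ)) :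
    conjSchwartz (c • f) = conj c • conjSchwartz f := by
  ext x
  simp [conjSchwartz_apply]

theorem lineDerivOp_conjSchwartz (m : EuclideanSpace ℝ (Fin n))
    (f : 𝓢(EuclideanSpace ℝ (Fin n), ℂ)) : ∂_{m} (conjSchwartz f) = conjSchwartz (∂_{m} f) := by
  ext x
  rw [conjSchwartz_apply, lineDerivOp_apply_eq_fderiv, lineDerivOp_apply_eq_fderiv]
  have h : HasFDerivAt (conjSchwartz f) ((Complex.conjCLE : ℂ →L[ℝ] ℂ) ∘L fderiv ℝ f x) x :=
    (Complex.conjCLE : ℂ →L[ℝ] ℂ).hasFDerivAt.comp x (f.hasFDerivAt x)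
  rw [h.fderiv]
  rfl

theorem opD_neg_X_conjSchwartz (j : Fin n) (f : 𝓢(EuclideanSpace ℝ (Fin n), ℂ)) :
    opD (-MvPolynomial.X j) (conjSchwartz f) = conjSchwartz (opD (MvPolynomial.X j) f) := by
  have h : (-MvPolynomial.X j : MvPolynomial (Fin n) ℝ) =
      MvPolynomial.C (-1) * MvPolynomial.X j := by
    simp
  rw [h, opD_mul, opD_C, opD_X, opD_X, lineDerivOp_conjSchwartz, conjSchwartz_smul, smul_smul]
  simp

/-- `P(-D)` is conjugate to `P(D)`. -/
theorem opD_reflect_conjSchwartz (Q : MvPolynomial (Fin n) ℝ)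
    (f : 𝓢(EuclideanSpace ℝ (Fin n), ℂ)) :
    opD (reflect Q) (conjSchwartz f) = conjSchwartz (opD Q f) := by
  induction Q using MvPolynomial.induction_on generalizing f with
  | C a =>
    have : reflect (MvPolynomial.C a : MvPolynomial (Fin n) ℝ) = MvPolynomial.C a := by
      simp [reflect, MvPolynomial.algebraMap_eq]
    rw [this, opD_C, opD_C, conjSchwartz_smul, Complex.conj_ofReal]
  | add p q hp hq =>
    have : reflect (p + q) = reflect p + reflect q := by simp [reflect]
    rw [this, opD_add, hp, hq, opD_add, map_add]
  | mul_X p j hp =>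
    have : reflect (p * MvPolynomial.X j) = reflect p * -MvPolynomial.X j := by simp [reflect]
    rw [this, opD_mul, opD_neg_X_conjSchwartz, hp, opD_mul]

/-- Complex conjugation of test functions. -/
def conjTest (ψ : 𝓓(Ω, ℂ)) : 𝓓(Ω, ℂ) where
  toFun x := conj (ψ x)
  contDiff' := Complex.conjCLE.contDiff.comp ψ.contDiff
  hasCompactSupport' := ψ.hasCompactSupport.comp_left (map_zero _)
  tsupport_subset' := (closure_mono (Function.support_comp_subset (map_zero _) ψ)).trans
    ψ.tsupport_subset

theorem toSchwartz_conjTest (ψ : 𝓓(Ω, ℂ)) :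
    toSchwartz (conjTest ψ) = conjSchwartz (toSchwartz ψ) := rfl

theorem diffOp_reflect_conjTest (P : MvPolynomial (Fin n) ℝ) (ψ : 𝓓(Ω, ℂ))
    (x : EuclideanSpace ℝ (Fin n)) :
    diffOp (reflect P) (conjTest ψ) x = conj (opD P (toSchwartz ψ) x) := by
  rw [diffOp_testFunction, toSchwartz_conjTest, opD_reflect_conjSchwartz, conjSchwartz_apply]

/-- Along the approximating sequence both `φ k` and `P(D) (φ k)` converge in `L²`, so the limit pair
lies in the closed graph. Its first entry is `u` continued by zero. -/
theorem exists_embed_ae_eq {P : MvPolynomial (Fin n) ℝ} {u : EuclideanSpace ℝ (Fin n) → ℂ}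
    (hu : MemH0 Ω P u) : ∃ h : graphSpace Ω P,
      embed Ω P h =ᵐ[volume] (Ω : Set (EuclideanSpace ℝ (Fin n))).indicator u := by
  obtain ⟨hu2, φ, hcau, hlim⟩ := hu
  have hΩ : MeasurableSet (Ω : Set (EuclideanSpace ℝ (Fin n))) := Ω.isOpen.measurableSet
  have hU : MemLp ((Ω : Set (EuclideanSpace ℝ (Fin n))).indicator u) 2 volume :=
    (memLp_indicator_iff_restrict hΩ).2 hu2
  have ha : Tendsto (fun k => toL2 (toSchwartz (φ k))) atTop (𝓝 (hU.toLp _)) := by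
    rw [tendsto_iff_edist_tendsto_0]
    refine hlim.congr fun k => ?_
    rw [← eLpNorm_indicator_eq_eLpNorm_restrict hΩ, Lp.edist_def]
    refine eLpNorm_congr_ae ?_
    filter_upwards [coeFn_toL2 (toSchwartz (φ k)), hU.coeFn_toLp] with x h1 h2
    rw [Pi.sub_apply, h1, h2, coe_toSchwartz]
    by_cases hx : x ∈ (Ω : Set (EuclideanSpace ℝ (Fin n)))
    · rw [Set.indicator_of_mem hx, Set.indicator_of_mem hx, Pi.sub_apply]
    · rw [Set.indicator_of_notMem hx, Set.indicator_of_notMem hx,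
        image_eq_zero_of_notMem_tsupport fun h => hx ((φ k).tsupport_subset h), sub_zero]
  have hb : CauchySeq fun k => toL2 (opD P (toSchwartz (φ k))) := by
    rw [EMetric.cauchySeq_iff]
    intro ε hε
    have h1 := hcau.eventually (gt_mem_nhds hε)
    obtain ⟨N, hN⟩ := eventually_atTop_prod_self'.1 h1
    refine ⟨N, fun k hk l hl => ?_⟩
    refine lt_of_eq_of_lt ?_ (hN k hk l hl)
    rw [Lp.edist_def, diffOp_testFunction, diffOp_testFunction]
    refine eLpNorm_congr_ae ?_
    filter_upwards [coeFn_toL2 (opD P (toSchwartz (φ k))),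
      coeFn_toL2 (opD P (toSchwartz (φ l)))] with x h1 h2
    rw [Pi.sub_apply, Pi.sub_apply, h1, h2]
  obtain ⟨F, hF⟩ := cauchySeq_tendsto_of_complete hb
  have hmem : WithLp.toLp 2 (hU.toLp _, F) ∈ graphSpace Ω P := by
    refine mem_closure_of_tendsto (b := atTop) (f := fun k => graphMap Ω P (φ k))
      (((WithLp.prodContinuousLinearEquiv 2 ℂ (L2 n) (L2 n)).symm.continuous.tendsto _).comp
        (ha.prodMk_nhds hF)) (Eventually.of_forall fun k => ⟨φ k, rfl⟩)
  exact ⟨⟨_, hmem⟩, hU.coeFn_toLp⟩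

/-- Symmetry of `P(D)` extended by density: on the completion the closed operator agrees with the
distributional one. -/
theorem inner_closedOp_ofTest (P : MvPolynomial (Fin n) ℝ) (z : ℂ) (ψ : 𝓓(Ω, ℂ))
    (h : graphSpace Ω P) :
    inner ℂ (toL2 (opD P (toSchwartz ψ) - conj z • toSchwartz ψ)) (embed Ω P h) =
      inner ℂ (toL2 (toSchwartz ψ)) (closedOp Ω P h - z • embed Ω P h) := by
  refine (denseRange_ofTest P).induction_on (p := fun h =>
    inner ℂ (toL2 (opD P (toSchwartz ψ) - conj z • toSchwartz ψ)) (embed Ω P h) =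
      inner ℂ (toL2 (toSchwartz ψ)) (closedOp Ω P h - z • embed Ω P h)) h
    (isClosed_eq (by fun_prop) (by fun_prop)) fun φ => ?_
  rw [embed_ofTest, closedOp_ofTest, map_sub, map_smul, inner_sub_left, inner_sub_right,
    inner_smul_left, inner_smul_right, inner_opD_left, Complex.conj_conj]

theorem inner_toL2_eq_setIntegral {g : 𝓢(EuclideanSpace ℝ (Fin n), ℂ)} (hg : tsupport g ⊆ Ω)
    {U : L2 n} {F : EuclideanSpace ℝ (Fin n) → ℂ}
    (hU : U =ᵐ[volume.restrict (Ω : Set (EuclideanSpace ℝ (Fin n)))] F) :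
    inner ℂ (toL2 g) U = ∫ x in (Ω : Set (EuclideanSpace ℝ (Fin n))), F x * conj (g x) := by
  have h1 : inner ℂ (toL2 g) U = ∫ x, U x * conj (g x) := by
    rw [MeasureTheory.L2.inner_def]
    refine integral_congr_ae ?_
    filter_upwards [coeFn_toL2 g] with x hx
    rw [hx, RCLike.inner_apply]
  rw [h1, ← setIntegral_eq_integral_of_forall_compl_eq_zero
    (s := (Ω : Set (EuclideanSpace ℝ (Fin n)))) fun x hx => by
      rw [image_eq_zero_of_notMem_tsupport fun h => hx (hg h), map_zero, mul_zero]]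
  refine integral_congr_ae ?_
  filter_upwards [hU] with x hx
  rw [hx]

theorem integrableOn_mul_of_memL2Loc {v g : EuclideanSpace ℝ (Fin n) → ℂ} (hv : MemL2Loc Ω v)
    (hg : MemLp g 2 volume) {K : Set (EuclideanSpace ℝ (Fin n))} (hK : IsCompact K)
    (hKΩ : K ⊆ Ω) (hgK : ∀ x ∉ K, g x = 0) :
    IntegrableOn (fun x => v x * g x) (Ω : Set (EuclideanSpace ℝ (Fin n))) := by
  have h1 : IntegrableOn (fun x => v x * g x) K := (hv K hK hKΩ).integrable_mul (hg.restrict K)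
  have h2 : (fun x => v x * g x) = K.indicator fun x => v x * g x := by
    funext x
    by_cases hx : x ∈ K
    · rw [Set.indicator_of_mem hx]
    · rw [Set.indicator_of_notMem hx, hgK x hx, mul_zero]
  rw [h2]
  exact ((integrable_indicator_iff hK.measurableSet).2 h1).integrableOn

/-- At a transmission eigenvalue the transmission form is degenerate. -/
theorem exists_degenerate_of_isTransmissionEigenvalue {P : MvPolynomial (Fin n) ℝ}
    {V r : EuclideanSpace ℝ (Fin n) → ℝ} (hV : MemLp V ∞ volume)
    (hr : MemLp (fun x => (r x : ℂ)) ∞ volume)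
    (hrV : ∀ᵐ x ∂(volume.restrict (Ω : Set (EuclideanSpace ℝ (Fin n)))), r x * V x = 1)
    {z : ℂ} (hz : IsTransmissionEigenvalue Ω P V z) :
    ∃ h : graphSpace Ω P, h ≠ 0 ∧ ∀ k : graphSpace Ω P,
      inner ℂ (closedOp Ω P k - conj z • embed Ω P k)
        (mulL2 hr (closedOp Ω P h - z • embed Ω P h) + embed Ω P h) = 0 := by
  obtain ⟨v, w, hv, hw, -, hw0, hvsol, hwsol, huH⟩ := hz
  obtain ⟨h, hh⟩ := exists_embed_ae_eq huH
  set s : Set (EuclideanSpace ℝ (Fin n)) := (Ω : Set (EuclideanSpace ℝ (Fin n))) with hs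
  have hsm : MeasurableSet s := Ω.isOpen.measurableSet
  have hhΩ : embed Ω P h =ᵐ[volume.restrict s] (v - w) := by
    filter_upwards [ae_restrict_of_ae hh, ae_restrict_mem hsm] with x h1 hx
    rw [h1, Set.indicator_of_mem hx]
  set G : L2 n := closedOp Ω P h - z • embed Ω P h with hG
  have hVc : MemLp (fun x => (V x : ℂ)) ∞ volume := hV.ofReal
  let adjTest : 𝓓(Ω, ℂ) → 𝓢(EuclideanSpace ℝ (Fin n), ℂ) := fun ψ =>
    opD P (toSchwartz ψ) - conj z • toSchwartz ψ
  have htest0 : ∀ ψ : 𝓓(Ω, ℂ), ∀ x ∉ tsupport ψ, adjTest ψ x = 0 := fun ψ x hx => by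
    have h1 : opD P (toSchwartz ψ) x = 0 := image_eq_zero_of_notMem_tsupport fun h =>
      hx (tsupport_opD_subset P _ h)
    have h2 : ψ x = 0 := image_eq_zero_of_notMem_tsupport hx
    change opD P (toSchwartz ψ) x - conj z * ψ x = 0
    rw [h1, h2, mul_zero, sub_zero]
  have htestΩ : ∀ ψ : 𝓓(Ω, ℂ), tsupport (adjTest ψ) ⊆ Ω := fun ψ =>
    (closure_minimal (s := Function.support (adjTest ψ))
      (fun x hx => not_not.1 fun h => Function.mem_support.1 hx (htest0 ψ x h))
      (isClosed_tsupport _)).trans ψ.tsupport_subset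
  have hconj : ∀ f : 𝓢(EuclideanSpace ℝ (Fin n), ℂ), MemLp (fun x => conj (f x)) 2 volume :=
    fun f => (conjSchwartz f).memLp 2 volume
  have hI : ∀ {y : EuclideanSpace ℝ (Fin n) → ℂ}, MemL2Loc Ω y → ∀ ψ : 𝓓(Ω, ℂ),
      IntegrableOn (fun x => y x * conj (adjTest ψ x)) s := fun hy ψ =>
    integrableOn_mul_of_memL2Loc hy (hconj _) ψ.hasCompactSupport ψ.tsupport_subset fun x hx => by
      rw [htest0 ψ x hx, map_zero]
  have hIV : ∀ ψ : 𝓓(Ω, ℂ), IntegrableOn (fun x => w x * (V x * conj (ψ x))) s := fun ψ => by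
    refine integrableOn_mul_of_memL2Loc hw ((hconj (toSchwartz ψ)).mul hVc)
      ψ.hasCompactSupport ψ.tsupport_subset fun x hx => ?_
    rw [image_eq_zero_of_notMem_tsupport hx, map_zero, mul_zero]
  -- The weak equation is bilinear and uses the transpose `P(-D)`; inserting the conjugate of `ψ`
  -- turns it into a Hermitian pairing with `(P - z̄) ψ`.
  have hv1 : ∀ ψ : 𝓓(Ω, ℂ), ∫ x in s, v x * conj (adjTest ψ x) = 0 := fun ψ => by
    rw [← hvsol (conjTest ψ)]
    refine integral_congr_ae (ae_of_all _ fun x => ?_)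
    simp only [diffOp_reflect_conjTest]
    change v x * conj (opD P (toSchwartz ψ) x - conj z * ψ x) =
      v x * (conj (opD P (toSchwartz ψ) x) + -z * conj (ψ x))
    rw [map_sub, map_mul, Complex.conj_conj]
    ring
  have hw1 : ∀ ψ : 𝓓(Ω, ℂ), ∫ x in s, w x * conj (adjTest ψ x) =
      -∫ x in s, w x * (V x * conj (ψ x)) := fun ψ => by
    rw [← add_eq_zero_iff_eq_neg, ← integral_add (hI hw ψ) (hIV ψ), ← hwsol (conjTest ψ)]
    refine integral_congr_ae (ae_of_all _ fun x => ?_)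
    simp only [diffOp_reflect_conjTest]
    change w x * conj (opD P (toSchwartz ψ) x - conj z * ψ x) + w x * (V x * conj (ψ x)) =
      w x * (conj (opD P (toSchwartz ψ) x) + (V x - z) * conj (ψ x))
    rw [map_sub, map_mul, Complex.conj_conj]
    ring
  have hu1 : ∀ ψ : 𝓓(Ω, ℂ), inner ℂ (toL2 (adjTest ψ)) (embed Ω P h) =
      ∫ x in s, w x * (V x * conj (ψ x)) := fun ψ => by
    rw [inner_toL2_eq_setIntegral (htestΩ ψ) hhΩ]
    have h1 : ∫ x in s, (v - w) x * conj (adjTest ψ x) =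
        (∫ x in s, v x * conj (adjTest ψ x)) - ∫ x in s, w x * conj (adjTest ψ x) := by
      rw [← integral_sub (hI hv ψ) (hI hw ψ)]
      refine integral_congr_ae (ae_of_all _ fun x => ?_)
      simp only [Pi.sub_apply, sub_mul]
    rw [h1, hv1, hw1]
    ring
  have hGint : ∀ ψ : 𝓓(Ω, ℂ), IntegrableOn (fun x => G x * conj (ψ x)) s := fun ψ =>
    ((Lp.memLp G).integrable_mul (hconj (toSchwartz ψ))).integrableOn
  have hG1 : ∀ ψ : 𝓓(Ω, ℂ), ∫ x in s, G x * conj (ψ x) =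
      ∫ x in s, w x * (V x * conj (ψ x)) := fun ψ => by
    rw [← hu1, inner_closedOp_ofTest]
    exact (inner_toL2_eq_setIntegral (g := toSchwartz ψ) ψ.tsupport_subset
      (Filter.EventuallyEq.refl _ _)).symm
  -- The identity `(P - z) u = V w` holds as distributions; both sides are locally integrable, so it
  -- holds almost everywhere.
  have hGw : ∀ᵐ x ∂(volume.restrict s), G x = w x * V x := by
    have hloc : LocallyIntegrableOn (fun x => G x - w x * V x) s := by
      rw [locallyIntegrableOn_iff Ω.isOpen.isLocallyClosed]
      intro K hKs hK
      have : IsFiniteMeasure (volume.restrict K) := ⟨by simpa using hK.measure_lt_top⟩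
      exact (((Lp.memLp G).restrict K).integrable one_le_two).sub
        (((hVc.restrict K).mul (hw K hK hKs) (r := 2)).integrable one_le_two)
    have hzero := Ω.isOpen.ae_eq_zero_of_integral_contDiff_smul_eq_zero hloc ?_
    · rw [ae_restrict_iff' hsm]
      filter_upwards [hzero] with x hx hxs
      exact sub_eq_zero.1 (hx hxs)
    · intro g hg hgc hgs
      let ψ : 𝓓(Ω, ℂ) :=
        { toFun := fun x => (g x : ℂ)
          contDiff' := Complex.ofRealCLM.contDiff.comp hg
          hasCompactSupport' := hgc.comp_left Complex.ofReal_zero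
          tsupport_subset' := (closure_mono
            (Function.support_comp_subset Complex.ofReal_zero g)).trans hgs }
      have hψ : ∀ x, conj (ψ x) = (g x : ℂ) := fun x => Complex.conj_ofReal (g x)
      rw [← setIntegral_eq_integral_of_forall_compl_eq_zero (s := s) fun x hx => by
        rw [image_eq_zero_of_notMem_tsupport fun h => hx (hgs h), zero_smul]]
      rw [← sub_eq_zero.2 (hG1 ψ), ← integral_sub (hGint ψ) (hIV ψ)]
      refine integral_congr_ae (ae_of_all _ fun x => ?_)
      simp only [hψ, Complex.real_smul]
      ring
  have hρG : mulL2 hr G =ᵐ[volume.restrict s] w := by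
    filter_upwards [ae_restrict_of_ae (coeFn_mulL2 hr G), hGw, hrV] with x h1 h2 h3
    rw [h1, h2, mul_comm (w x), ← mul_assoc, ← Complex.ofReal_mul, h3, Complex.ofReal_one, one_mul]
  refine ⟨h, ?_, fun k => ?_⟩
  · rintro rfl
    apply hw0
    have hG0 : G = 0 := by rw [hG, map_zero, map_zero, smul_zero, sub_zero]
    rw [hG0, map_zero] at hρG
    exact hρG.symm.trans (ae_restrict_of_ae (Lp.coeFn_zero ℂ 2 volume))
  · refine (denseRange_ofTest P).induction_on (p := fun k =>
      inner ℂ (closedOp Ω P k - conj z • embed Ω P k) (mulL2 hr G + embed Ω P h) = 0) k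
      (isClosed_eq (by fun_prop) (by fun_prop)) fun ψ => ?_
    have h1 : closedOp Ω P (ofTest P ψ) - conj z • embed Ω P (ofTest P ψ) = toL2 (adjTest ψ) := by
      rw [closedOp_ofTest, embed_ofTest, map_sub, map_smul]
    -- On `Ω` the second argument is `w + (v - w) = v`, so the two pairings cancel.
    rw [h1, inner_add_right, hu1, inner_toL2_eq_setIntegral (htestΩ ψ) hρG, hw1]
    ring

/-- The reciprocal of the potential in `Ω`, continued by `1`. -/
theorem exists_reciprocal {V : EuclideanSpace ℝ (Fin n) → ℝ} (hV : MemLp V ∞ volume) {δ : ℝ}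
    (hδ : 0 < δ)
    (hVδ : ∀ᵐ x ∂(volume.restrict (Ω : Set (EuclideanSpace ℝ (Fin n)))), δ ≤ V x) :
    ∃ (r : EuclideanSpace ℝ (Fin n) → ℝ) (c : ℝ), 0 < c ∧
      MemLp (fun x => (r x : ℂ)) ∞ volume ∧ (∀ᵐ x, c ≤ r x) ∧
      ∀ᵐ x ∂(volume.restrict (Ω : Set (EuclideanSpace ℝ (Fin n)))), r x * V x = 1 := by
  classical
  set s : Set (EuclideanSpace ℝ (Fin n)) := (Ω : Set (EuclideanSpace ℝ (Fin n))) with hs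
  have hsm : MeasurableSet s := Ω.isOpen.measurableSet
  set M : ℝ := (eLpNorm V ∞ volume).toReal with hM
  have hVM : ∀ᵐ x, ‖V x‖ ≤ M := by
    have h1 := ae_le_eLpNormEssSup (f := V) (μ := volume)
    filter_upwards [h1] with x hx
    rw [hM, eLpNorm_exponent_top, ← toReal_enorm]
    refine ENNReal.toReal_mono ?_ hx
    rw [← eLpNorm_exponent_top]
    exact hV.2.ne
  have hVδ' := (ae_restrict_iff' hsm).1 hVδ
  -- Only values in `Ω` matter, but coercivity is required on all of `L²(ℝⁿ)`; the value `1` outside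
  -- keeps `r` bounded and bounded away from zero.
  set r : EuclideanSpace ℝ (Fin n) → ℝ := s.piecewise (fun x => (V x)⁻¹) fun _ => 1 with hr
  refine ⟨r, (max M 1)⁻¹, by positivity, ?_, ?_, ?_⟩
  · have hmeas : AEStronglyMeasurable r volume := AEStronglyMeasurable.piecewise hsm
      hV.1.aemeasurable.inv.aestronglyMeasurable.restrict aestronglyMeasurable_const
    have hbound : ∀ᵐ x, ‖r x‖ ≤ max δ⁻¹ 1 := by
      filter_upwards [hVδ'] with x hx
      by_cases hxs : x ∈ s
      · rw [hr, Set.piecewise_eq_of_mem _ _ _ hxs, norm_inv]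
        exact le_max_of_le_left (inv_anti₀ hδ ((hx hxs).trans (Real.le_norm_self _)))
      · rw [hr, Set.piecewise_eq_of_notMem _ _ _ hxs, norm_one]
        exact le_max_right _ _
    exact MemLp.ofReal (memLp_top_of_bound hmeas (max δ⁻¹ 1) hbound)
  · filter_upwards [hVδ', hVM] with x hx hxM
    by_cases hxs : x ∈ s
    · rw [hr, Set.piecewise_eq_of_mem _ _ _ hxs]
      exact inv_anti₀ (hδ.trans_le (hx hxs))
        ((Real.le_norm_self _).trans (hxM.trans (le_max_left _ _)))
    · rw [hr, Set.piecewise_eq_of_notMem _ _ _ hxs]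
      exact inv_le_one_of_one_le₀ (le_max_right _ _)
  · filter_upwards [hVδ, ae_restrict_mem hsm] with x hx hxs
    rw [hr, Set.piecewise_eq_of_mem _ _ _ hxs]
    exact inv_mul_cancel₀ (hδ.trans_le hx).ne'

end ITP

end

theorem theorem3p3 {n : ℕ} (Ω : Opens (EuclideanSpace ℝ (Fin n)))
    (hΩ_conn : IsConnected (Ω : Set (EuclideanSpace ℝ (Fin n))))
    (hΩ_bdd : Bornology.IsBounded (Ω : Set (EuclideanSpace ℝ (Fin n))))
    (V : EuclideanSpace ℝ (Fin n) → ℝ) (hV : MemLp V ∞ volume)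
    (hV_supp : ITP.essSupport V = closure (Ω : Set (EuclideanSpace ℝ (Fin n))))
    (δ : ℝ) (hδ : 0 < δ)
    (hV_lower : ∀ᵐ x ∂(volume.restrict (Ω : Set (EuclideanSpace ℝ (Fin n)))), δ ≤ V x)
    (P : MvPolynomial (Fin n) ℝ) (hP_order : 2 ≤ P.totalDegree)
    (hP_tilde : Tendsto (ITP.symbolTilde P) (cocompact (EuclideanSpace ℝ (Fin n))) atTop)
    (hP_below : (∃ C : ℝ, ∀ ξ, C ≤ ITP.symbol P ξ) ∨ (∃ C : ℝ, ∀ ξ, C ≤ -ITP.symbol P ξ)) :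
    IsClosed {z : ℂ | ITP.IsTransmissionEigenvalue Ω P V z} ∧
      IsDiscrete {z : ℂ | ITP.IsTransmissionEigenvalue Ω P V z} := by
  obtain ⟨r, c, hc, hr, hrc, hrV⟩ := ITP.exists_reciprocal hV hδ hV_lower
  refine isClosed_and_isDiscrete_of_finite_inter_closedBall fun R => ?_
  refine (finite_degenerate_transmission_form (p := ITP.closedOp Ω P) (j := ITP.embed Ω P)
    (ρ := ITP.mulL2 hr) hc (ITP.isCompactOperator_embed hΩ_bdd hP_tilde)
    (fun h => (ITP.norm_sq_graphSpace P h).le) (ITP.le_re_inner_mulL2 hr hrc)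
    (ITP.exists_le_re_inner hP_below) R).subset ?_
  rintro z ⟨hzR, hz⟩
  exact ⟨hzR, ITP.exists_degenerate_of_isTransmissionEigenvalue hV hr hrV hz⟩
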